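/- **Setting.** Let $0<\gamma<1$ and let the system size $n$ tend to infinity through values for which $n_1=\gamma n$ and $n_2=(1-\gamma)n$ are integers. The $n$-system has a big node $b$ and small nodes in two groups $\mathcal G_1=\{1,\dots,n_1\}$, $\mathcal G_2=\{1,\dots,n_2\}$; put $m'=3-m$. For small nodes $j\in\mathcal G_m$ and $i$, let $I_{j,i}\in\{0,1\}$ be the indicator of the directed edge from $j$ to $i$, with $P(I_{j,i}=1)=p_m>0$ if $i\in\mathcal G_m$ and $P(I_{j,i}=1)=p_{c_m}$ if $i\in\mathcal G_{m'}$. Let $G^m_i$, $\eta^{sb}_i\in[0,1]$, and $\eta^{bs}_i$ (bounded) be random variables, each family i.i.d. within each group $m$; all these random variables and all the $I_{j,i}$ are mutually independent. Let $0<\lambda_m\le 1$ and $p^{sb}_m=E[\eta^{sb}_j]<1$ ($j\in\mathcal G_m$). For $j\in\mathcal G_m$ the weights are $W_{j,b}=\lambda_m\eta^{sb}_j$ and $$W_{j,i}=\frac{I_{j,i}(1-\eta^{sb}_j)\lambda_m}{\sum_{i'\in\mathcal G_m}I_{j,i'}}\ (i\in\mathcal G_m),\qquad W_{j,i}=\frac{I_{j,i}(1-\lambda_m)}{\sum_{i'\in\mathcal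 G_{m'}}I_{j,i'}}1_{p_{c_m}>0}\ (i\in\mathcal G_{m'}).$$ The performances solve the random fixed point system $$X^m_i=f^m(G^m_i,\bar X^{m1}_i,\bar X^{m2}_i,\eta^{bs}_iX^b)\ (i\in\mathcal G_m,\ m=1,2),\qquad X^b=f^b(\bar X^b),$$ $$\bar X^{ml}_i=\sum_{j\in\mathcal G_l}X^l_jW_{j,i}\ (l=1,2),\qquad \bar X^b=\frac1n\sum_{l=1}^2\sum_{j\in\mathcal G_l}X^l_jW_{j,b}.$$ For $i \in \mathcal G_m$ write $\xi^m_i(x^1,x^2,x_b)=f^m(G^m_i,x^1,x^2,\eta^{bs}_ix_b)$. The aggregates are the fixed points of the aggregate map $\bar{\mathbf f}^n$ sending $(\bar x_b,\{\bar x^{ml}_i\})$ to the vector with components $\sum_{j\in\mathcal G_l}\xi^l_j(\bar x^{l1}_j,\bar x^{l2}_j,f^b(\bar x_b))W_{j,i}$ for $i\in\mathcal G_m$ (and $0$ for $i>n_m$) and $\frac1n\sum_l\sum_{j\in\mathcal G_l}\xi^l_j(\bar x^{l1}_j,\bar x^{l2}_j,f^b(\bar x_b))W_{j,b}$. The limit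 system is the componentwise $\limsup_{n}$ of $\bar{\mathbf f}^n$. **Assumptions.** (B.1) $f^1,f^2,f^b$ are non-negative, continuous (and measurable) and bounded by a constant $y$. (B.2$'$) Almost surely, for $m=1,2$, $$\sum_{j\in\mathcal G_m}\Big|\frac1{\sum_{i\in\mathcal G_m}I_{j,i}}-\frac1{n_mp_m}\Big|\to0\quad\text{and, if }p_{c_m}>0,\quad\sum_{j\in\mathcal G_m}\Big|\frac1{\sum_{i\in\mathcal G_{m'}}I_{j,i}}-\frac1{n_{m'}p_{c_m}}\Big|\to0 .$$ (B.3$'$) For some $\sigma,\varsigma\in[0,1]$, almost surely $|\xi^m_i(x^1,x^2,x_b)-\xi^m_i(u^1,u^2,u_b)|\le\sigma(|x^1-u^1|+|x^2-u^2|+\varsigma|x_b-u_b|)$ for all arguments and all $i,m$; and $|f^b(x)-f^b(u)|\le|x-u|$. (B.4$'$) $$\max\Big\{\lambda_1(1-p^{sb}_1)+\tfrac{1-\gamma}{\gamma}(1-\lambda_2)1_{p_{c_2}>0},\ \tfrac{\gamma}{1-\gamma}(1-\lambda_1)1_{p_{c_1}>0}+\lambda_2(1-p^{sb}_2)\Big\}+\gamma\lambda_1p^{sb}_1+(1-\gamma)\lambda_2p^{sb}_2\le1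 .$$ Moreover $\eta^{sb}_j\ge\underline\eta\ge0$ a.s. for all $j$, with $\sigma(1-\underline\eta+\varsigma\underline\eta)<1$. **Conclusion.** Put $$\mu_1=\frac{1-\gamma}{\gamma}\frac{1-\lambda_2}{\lambda_2}\frac{1}{1-p^{sb}_2}1_{p_{c_2}>0},\qquad \mu_2=\frac{\gamma}{1-\gamma}\frac{1-\lambda_1}{\lambda_1}\frac{1}{1-p^{sb}_1}1_{p_{c_1}>0}.$$ There are real constants $\bar x_b^\infty$ and $\bar x^{\infty,ml}$ ($m,l\in\{1,2\}$) with $\bar x^{\infty,12}=\mu_1\bar x^{\infty,22}$ and $\bar x^{\infty,21}=\mu_2\bar x^{\infty,11}$, such that $(\bar x_b^\infty,\bar x^{\infty,11},\bar x^{\infty,22})$ is the unique fixed point of the three-dimensional map sending $(\bar x_b,\bar x^1,\bar x^2)$, with $x_b=f^b(\bar x_b)$, to the triple with components $$\gamma E[\xi^1_i(\bar x^1,\mu_1\bar x^2,x_b)]\lambda_1p^{sb}_1+(1-\gamma)E[\xi^2_i(\mu_2\bar x^1,\bar x^2,x_b)]\lambda_2p^{sb}_2,$$ $$E[\xi^1_i(\bar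 x^1,\mu_1\bar x^2,x_b)]\lambda_1(1-p^{sb}_1),\qquad E[\xi^2_i(\mu_2\bar x^1,\bar x^2,x_b)]\lambda_2(1-p^{sb}_2),$$ and such that almost surely: the constant sequence $\bar x^{ml}_i=\bar x^{\infty,ml}$ together with $\bar x_b^\infty$ is a fixed point of the limit system; every $n$-system has a fixed point; and for any choice of fixed points, one for each $n$, as $n\to\infty$ along the full sequence, $$\bar X^{ml}_i(n)\to\bar x^{\infty,ml},\qquad \bar X^b(n)\to\bar x^\infty_b,\qquad X^b(n)\to f^b(\bar x_b^\infty),$$ $$X^m_i(n)\to f^m\big(G^m_i,\bar x^{\infty,m1},\bar x^{\infty,m2},\eta^{bs}_if^b(\bar x_b^\infty)\big)\quad\text{for all }i,m,l .$$ -/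

import Mathlib

open MeasureTheory ProbabilityTheory Filter Topology

namespace RandomFP

/-- A small node: its group (`0` is the first group, `1` the second) and its number in the group,
counted from `0`. The node `(m, i)` belongs to a finite system with group sizes `s` when
`i < s m`. -/
abbrev Node := Fin 2 × ℕ

/-- The data of the network with one big node and two groups of small nodes. -/
structure Model (Ω 𝒢 : Type*) where
  /-- fraction of small nodes in the first group -/
  gam : ℝ
  /-- fraction of the weight of a node of group `m` that is dedicated to its own group
  (and the big node) -/
  lam : Fin 2 → ℝ
  /-- edge probability inside group `m` -/
  p : Fin 2 → ℝ
  /-- probability of an edge from a node of group `m` to a node of the other group -/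
  pc : Fin 2 → ℝ
  /-- performance function of the big node -/
  fb : ℝ → ℝ
  /-- performance function of the nodes of group `m` -/
  f : Fin 2 → 𝒢 → ℝ → ℝ → ℝ → ℝ
  /-- `I j i` is the indicator of the directed edge from `j` to `i` -/
  I : Node → Node → Ω → ℝ
  /-- individual random input of a node -/
  G : Node → Ω → 𝒢
  /-- random fraction directed towards the big node -/
  etaSB : Node → Ω → ℝ
  /-- random weight of the influence of the big node -/
  etaBS : Node → Ω → ℝ

/-- Labels of all the primitive random variables. -/
inductive Source
  | edge (j i : Node)
  | shock (j : Node)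
  | toBig (j : Node)
  | fromBig (j : Node)

namespace Model

variable {Ω 𝒢 : Type*}

/-- The σ-algebra generated by one primitive random variable. -/
@[reducible] def sourceSigma [MeasurableSpace 𝒢] (M : Model Ω 𝒢) : Source → MeasurableSpace Ω
  | .edge j i => MeasurableSpace.comap (M.I j i) inferInstance
  | .shock j => MeasurableSpace.comap (M.G j) inferInstance
  | .toBig j => MeasurableSpace.comap (M.etaSB j) inferInstance
  | .fromBig j => MeasurableSpace.comap (M.etaBS j) inferInstance

/-- The standing probabilistic description of the random network. -/
structure IsRandomNetwork [MeasurableSpace Ω] [MeasurableSpace 𝒢] (M : Model Ω 𝒢)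
    (P : Measure Ω) : Prop where
  gam_pos : 0 < M.gam
  gam_lt_one : M.gam < 1
  lam_nonneg : ∀ m, 0 ≤ M.lam m
  lam_le_one : ∀ m, M.lam m ≤ 1
  measurable_I : ∀ j i, Measurable (M.I j i)
  I_eq : ∀ j i ω, M.I j i ω = 0 ∨ M.I j i ω = 1
  prob_I : ∀ j i, P.real {ω | M.I j i ω = 1} = if i.1 = j.1 then M.p j.1 else M.pc j.1
  measurable_G : ∀ j, Measurable (M.G j)
  identDistrib_G : ∀ m i, IdentDistrib (M.G (m, i)) (M.G (m, 0)) P P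
  measurable_etaSB : ∀ j, Measurable (M.etaSB j)
  identDistrib_etaSB : ∀ m i, IdentDistrib (M.etaSB (m, i)) (M.etaSB (m, 0)) P P
  etaSB_mem : ∀ j, ∀ᵐ ω ∂P, M.etaSB j ω ∈ Set.Icc (0 : ℝ) 1
  measurable_etaBS : ∀ j, Measurable (M.etaBS j)
  identDistrib_etaBS : ∀ m i, IdentDistrib (M.etaBS (m, i)) (M.etaBS (m, 0)) P P
  etaBS_bounded : ∃ C : ℝ, ∀ j, ∀ᵐ ω ∂P, |M.etaBS j ω| ≤ C
  indep : iIndep M.sourceSigma P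

/-- The mean `p_m^{sb}` of the fractions directed towards the big node. -/
noncomputable def psb [MeasurableSpace Ω] (M : Model Ω 𝒢) (P : Measure Ω) (m : Fin 2) : ℝ :=
  ∫ ω, M.etaSB (m, 0) ω ∂P

/-- The indicator of `p_{c_m} > 0`. -/
noncomputable def crossInd (M : Model Ω 𝒢) (m : Fin 2) : ℝ := if 0 < M.pc m then 1 else 0

/-- The weight `W_{j,i}` between small nodes in the system with group sizes `s`. -/
noncomputable def W (M : Model Ω 𝒢) (s : Fin 2 → ℕ) (ω : Ω) (j i : Node) : ℝ :=
  if i.1 = j.1 then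
    M.I j i ω * (1 - M.etaSB j ω) * M.lam j.1 / ∑ i' ∈ Finset.range (s j.1), M.I j (j.1, i') ω
  else
    M.I j i ω * (1 - M.lam j.1) / (∑ i' ∈ Finset.range (s i.1), M.I j (i.1, i') ω)
      * M.crossInd j.1

/-- The weight `W_{j,b}` towards the big node. -/
noncomputable def Wb (M : Model Ω 𝒢) (ω : Ω) (j : Node) : ℝ := M.etaSB j ω * M.lam j.1

/-- The aggregate that node `i` receives from group `m'`. -/
noncomputable def agg (M : Model Ω 𝒢) (s : Fin 2 → ℕ) (ω : Ω) (X : Node → ℝ) (i : Node)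
    (m' : Fin 2) : ℝ :=
  ∑ j ∈ Finset.range (s m'), X (m', j) * M.W s ω (m', j) i

/-- The aggregate that the big node receives (per small node). -/
noncomputable def aggBig (M : Model Ω 𝒢) (s : Fin 2 → ℕ) (ω : Ω) (X : Node → ℝ) : ℝ :=
  1 / ((s 0 : ℝ) + s 1) * ∑ j ∈ Finset.range (s 0), X (0, j) * M.Wb ω (0, j)
    + 1 / ((s 0 : ℝ) + s 1) * ∑ j ∈ Finset.range (s 1), X (1, j) * M.Wb ω (1, j)

/-- The random variable `ξ_j`. -/
def xi (M : Model Ω 𝒢) (ω : Ω) (j : Node) (x₁ x₂ xb : ℝ) : ℝ :=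
  M.f j.1 (M.G j ω) x₁ x₂ (M.etaBS j ω * xb)

/-- The fixed point map of the system with group sizes `s`, acting on the performances
`(X_b, X)`; components that do not belong to a node of the system are set to `0`. -/
noncomputable def sysMap (M : Model Ω 𝒢) (s : Fin 2 → ℕ) (ω : Ω) (z : ℝ × (Node → ℝ)) :
    ℝ × (Node → ℝ) :=
  (M.fb (M.aggBig s ω z.2),
    fun i => if i.2 < s i.1 then M.xi ω i (M.agg s ω z.2 i 0) (M.agg s ω z.2 i 1) z.1 else 0)

/-- The map of the system with group sizes `s` on aggregates `(x̄_b, x̄)`, where `x̄ i m'` is the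
aggregate of node `i` from group `m'`; components that do not belong to a node of the system are
set to `0`. -/
noncomputable def aggMap (M : Model Ω 𝒢) (s : Fin 2 → ℕ) (ω : Ω)
    (z : ℝ × (Node → Fin 2 → ℝ)) : ℝ × (Node → Fin 2 → ℝ) :=
  (M.aggBig s ω (fun j => M.xi ω j (z.2 j 0) (z.2 j 1) (M.fb z.1)),
    fun i m' => if i.2 < s i.1 then
      M.agg s ω (fun j => M.xi ω j (z.2 j 0) (z.2 j 1) (M.fb z.1)) i m' else 0)

/-- The limit system: componentwise upper limit of the aggregate maps along a sequence of
systems. -/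
noncomputable def limitMap (M : Model Ω 𝒢) (s : ℕ → Fin 2 → ℕ) (ω : Ω)
    (z : ℝ × (Node → Fin 2 → ℝ)) : ℝ × (Node → Fin 2 → ℝ) :=
  (limsup (fun k => (M.aggMap (s k) ω z).1) atTop,
    fun i m' => limsup (fun k => (M.aggMap (s k) ω z).2 i m') atTop)

/-- The group sizes run through systems whose total size `n` tends to infinity and whose first
group has exactly `γ n` nodes (so the second one has `(1 - γ) n`). -/
structure IsSizeSequence (M : Model Ω 𝒢) (s : ℕ → Fin 2 → ℕ) : Prop where
  tendsto_size : Tendsto (fun k => s k 0 + s k 1) atTop atTop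
  size_zero : ∀ k, (s k 0 : ℝ) = M.gam * ((s k 0 : ℝ) + s k 1)

/-- Assumption B.1: the functions are non-negative, continuous in their real arguments,
measurable, and bounded by `y`. -/
structure AssumptionB1 [MeasurableSpace 𝒢] (M : Model Ω 𝒢) (y : ℝ) : Prop where
  measurable_f : ∀ m, Measurable (fun q : 𝒢 × ℝ × ℝ × ℝ => M.f m q.1 q.2.1 q.2.2.1 q.2.2.2)
  continuous_f : ∀ m g, Continuous (fun q : ℝ × ℝ × ℝ => M.f m g q.1 q.2.1 q.2.2)
  continuous_fb : Continuous M.fb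
  f_mem : ∀ m g x₁ x₂ xb, M.f m g x₁ x₂ xb ∈ Set.Icc 0 y
  fb_mem : ∀ x, M.fb x ∈ Set.Icc 0 y

/-- Assumption B.2': for almost every realization, the numbers of edges from a node into each
of the groups behave like their means, in the summed sense. In `Fin 2`, `1 - m` is the group other
than `m`. -/
structure AssumptionB2 [MeasurableSpace Ω] (M : Model Ω 𝒢) (P : Measure Ω)
    (s : ℕ → Fin 2 → ℕ) : Prop where
  p_pos : ∀ m, 0 < M.p m
  own : ∀ᵐ ω ∂P, ∀ m, Tendsto (fun k => ∑ j ∈ Finset.range (s k m),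
    |1 / (∑ i ∈ Finset.range (s k m), M.I (m, j) (m, i) ω) - 1 / ((s k m : ℝ) * M.p m)|)
    atTop (𝓝 0)
  cross : ∀ᵐ ω ∂P, ∀ m, 0 < M.pc m → Tendsto (fun k => ∑ j ∈ Finset.range (s k m),
    |1 / (∑ i ∈ Finset.range (s k (1 - m)), M.I (m, j) (1 - m, i) ω)
      - 1 / ((s k (1 - m) : ℝ) * M.pc m)|)
    atTop (𝓝 0)

/-- Assumption B.3': Lipschitz conditions, with constants `sig` and `vsig`. -/
structure AssumptionB3 [MeasurableSpace Ω] (M : Model Ω 𝒢) (P : Measure Ω) (sig vsig : ℝ) :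
    Prop where
  sig_nonneg : 0 ≤ sig
  sig_le_one : sig ≤ 1
  vsig_nonneg : 0 ≤ vsig
  vsig_le_one : vsig ≤ 1
  lipschitz_xi : ∀ j, ∀ᵐ ω ∂P, ∀ x₁ x₂ xb u₁ u₂ ub : ℝ,
    |M.xi ω j x₁ x₂ xb - M.xi ω j u₁ u₂ ub| ≤ sig * (|x₁ - u₁| + |x₂ - u₂| + vsig * |xb - ub|)
  lipschitz_fb : ∀ x u : ℝ, |M.fb x - M.fb u| ≤ |x - u|

/-- The constant `ϱ` of assumption B.4'. -/
noncomputable def rho [MeasurableSpace Ω] (M : Model Ω 𝒢) (P : Measure Ω) : ℝ :=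
  max (M.lam 0 * (1 - M.psb P 0) + (1 - M.gam) / M.gam * (1 - M.lam 1) * M.crossInd 1)
      (M.gam / (1 - M.gam) * (1 - M.lam 0) * M.crossInd 0 + M.lam 1 * (1 - M.psb P 1))
    + (M.gam * M.lam 0 * M.psb P 0 + (1 - M.gam) * M.lam 1 * M.psb P 1)

/-- The constant `μ_1`. -/
noncomputable def mu₁ [MeasurableSpace Ω] (M : Model Ω 𝒢) (P : Measure Ω) : ℝ :=
  (1 - M.gam) / M.gam * ((1 - M.lam 1) / M.lam 1) * (1 / (1 - M.psb P 1)) * M.crossInd 1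

/-- The constant `μ_2`. -/
noncomputable def mu₂ [MeasurableSpace Ω] (M : Model Ω 𝒢) (P : Measure Ω) : ℝ :=
  M.gam / (1 - M.gam) * ((1 - M.lam 0) / M.lam 0) * (1 / (1 - M.psb P 0)) * M.crossInd 0

/-- The mean of `ξ_i`, for any node `i` of group `m`. -/
noncomputable def meanXi [MeasurableSpace Ω] (M : Model Ω 𝒢) (P : Measure Ω) (m : Fin 2)
    (x₁ x₂ xb : ℝ) : ℝ :=
  ∫ ω, M.xi ω (m, 0) x₁ x₂ xb ∂P

/-- The three dimensional system, in the variables `(x̄_b, x̄^1, x̄^2)`. -/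
noncomputable def threeDimMap [MeasurableSpace Ω] (M : Model Ω 𝒢) (P : Measure Ω)
    (z : ℝ × ℝ × ℝ) : ℝ × ℝ × ℝ :=
  (M.gam * M.meanXi P 0 z.2.1 (M.mu₁ P * z.2.2) (M.fb z.1) * M.lam 0 * M.psb P 0
      + (1 - M.gam) * M.meanXi P 1 (M.mu₂ P * z.2.1) z.2.2 (M.fb z.1) * M.lam 1 * M.psb P 1,
    M.meanXi P 0 z.2.1 (M.mu₁ P * z.2.2) (M.fb z.1) * M.lam 0 * (1 - M.psb P 0),
    M.meanXi P 1 (M.mu₂ P * z.2.1) z.2.2 (M.fb z.1) * M.lam 1 * (1 - M.psb P 1))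

end Model

end RandomFP

/-!
The theorem rests on one contraction estimate, in an averaged `ℓ¹` norm over the nodes. A node `j`
directs the weight `lam * etaSB j` to the big node and at most `1 - lam * etaSB j` to the small
nodes (`IsRegular.sum_W_le`), and the response to the big node is damped by `vsig`. Summed over the
receiving nodes, the influence of `j` is at most `sig * (1 - lam * etaSB j * (1 - vsig))`, hence at
most `kappa`, which is below `1` (`kappa_lt_one`,
`IsRegular.sum_abs_response_sub_response_le`). So every finite system has a fixed point, by Banach's
theorem. The same computation for the mean performances of the two groups, with the `ℓ¹` norm
weighted by the group sizes, gives the unique fixed point of the mean-field map `meanResponse`, and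
with it the unique fixed point of `threeDimMap`, in which only the aggregates appear
(`existsUnique_meanResponse_fixedPoint`, `isFixedPt_threeDimMap_iff`).

For the convergence, freeze the aggregates at their limits `x`, `xb` and let `Y j` be the
performance of node `j` that they produce. After the numbers of edges have been replaced by their
means, which `AssumptionB2` allows, the aggregates of `Y` at a single node are averages of
independent bounded variables whose mean is known by the mean-field equation. Hoeffding's inequality
and the Borel–Cantelli lemma make these averages converge almost surely, uniformly over the nodes of
the system (`ae_eventually_abs_sum_sub_le`, `IsRegular.eventually_abs_agg_sub_le`). Hence `Y` solves
the finite system up to a uniformly small error, and the contraction estimate bounds the average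
distance between `Y` and any fixed point (`IsRegular.tendsto_average_sub`). A single node is reached
by each other node with a weight of order at most `1 / n`, up to the error that `AssumptionB2`
controls, so closeness on average already forces the convergence of each individual aggregate
(`IsRegular.tendsto_agg`), and continuity gives that of the performances.
-/

namespace RandomFP

/-! ### Independence of blocks and uniform laws of large numbers -/

section Probability

variable {Ω : Type*} {mΩ : MeasurableSpace Ω} {P : Measure Ω}

/-- Joining the σ-algebras of an independent family along pairwise disjoint blocks gives an
independent family. -/
theorem iIndep_iSup_of_pairwise_disjoint [IsProbabilityMeasure P] {ι κ : Type*}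
    {m : ι → MeasurableSpace Ω} (h_le : ∀ i, m i ≤ mΩ) (h : iIndep m P) {S : κ → Set ι}
    (hS : Pairwise fun j k => Disjoint (S j) (S k)) :
    iIndep (fun j => ⨆ i ∈ S j, m i) P := by
  classical
  rw [iIndep_iff]
  intro t A
  induction t using Finset.induction_on with
  | empty => simp
  | insert a t ha ih =>
    intro hA
    have hdisj : Disjoint (S a) (⋃ j ∈ t, S j) := by
      rw [Set.disjoint_iUnion₂_right]
      intro j hj
      exact hS (by rintro rfl; exact ha hj)
    have hind := indep_iSup_of_disjoint h_le h hdisj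
    rw [Indep_iff] at hind
    have hmeas : MeasurableSet[⨆ i ∈ ⋃ j ∈ t, S j, m i] (⋂ j ∈ t, A j) := by
      refine Finset.measurableSet_biInter t fun j hj => ?_
      have hle : (⨆ i ∈ S j, m i) ≤ ⨆ i ∈ ⋃ j ∈ t, S j, m i :=
        biSup_mono fun i hi => Set.mem_biUnion (by exact hj) hi
      exact hle _ (hA j (Finset.mem_insert_of_mem hj))
    rw [Finset.set_biInter_insert, Finset.prod_insert ha,
      hind _ _ (hA a (Finset.mem_insert_self a t)) hmeas,
      ih fun j hj => hA j (Finset.mem_insert_of_mem hj)]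

/-- The two-sided Hoeffding inequality for averages of independent variables with values in
`[-C, C]` and common mean `c`. -/
theorem measureReal_lt_abs_sum_sub_le [IsProbabilityMeasure P] {U : ℕ → Ω → ℝ} {C c ε : ℝ}
    (hC : 0 < C) (hε : 0 ≤ ε)
    (hind : iIndepFun U P) (hmeas : ∀ j, Measurable (U j)) (hb : ∀ j, ∀ᵐ ω ∂P, |U j ω| ≤ C)
    (hmean : ∀ j, ∫ ω, U j ω ∂P = c) (n : ℕ) :
    P.real {ω | ε * n < |∑ j ∈ Finset.range n, U j ω - n * c|}
      ≤ 2 * Real.exp (-(ε ^ 2 / (2 * C ^ 2) * n)) := by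
  have hIcc : ∀ j, ∀ᵐ ω ∂P, U j ω ∈ Set.Icc (-C) C := fun j => by
    filter_upwards [hb j] with ω hω using abs_le.mp hω
  have hsub : ∀ j, HasSubgaussianMGF (fun ω => U j ω - c) ((‖C - -C‖₊ / 2) ^ 2) P := fun j => by
    rw [← hmean j]
    exact hasSubgaussianMGF_of_mem_Icc (hmeas j).aemeasurable (hIcc j)
  have hind' : iIndepFun (fun j ω => U j ω - c) P :=
    hind.comp (fun _ x => x - c) fun _ => measurable_id.sub_const c
  have hind'' : iIndepFun (fun j ω => -(U j ω - c)) P :=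
    hind'.comp (fun _ x => -x) fun _ => measurable_neg
  have hexp : Real.exp (-(ε * n) ^ 2 / (2 * n * (((‖C - -C‖₊ / 2) ^ 2 : NNReal) : ℝ)))
      = Real.exp (-(ε ^ 2 / (2 * C ^ 2) * n)) := by
    congr 1
    have : (((‖C - -C‖₊ / 2) ^ 2 : NNReal) : ℝ) = C ^ 2 := by
      push_cast
      rw [Real.norm_eq_abs, sub_neg_eq_add, abs_of_pos (by linarith)]
      ring
    rw [this]
    rcases Nat.eq_zero_or_pos n with rfl | hn
    · simp
    · have : (0 : ℝ) < n := by exact_mod_cast hn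
      field_simp
  have h1 := HasSubgaussianMGF.measure_sum_range_ge_le_of_iIndepFun hind' (n := n)
    (fun j _ => hsub j) (mul_nonneg hε n.cast_nonneg)
  have h2 := HasSubgaussianMGF.measure_sum_range_ge_le_of_iIndepFun hind'' (n := n)
    (fun j _ => (hsub j).neg) (mul_nonneg hε n.cast_nonneg)
  rw [hexp] at h1 h2
  calc _ ≤ P.real ({ω | ε * n ≤ ∑ j ∈ Finset.range n, (U j ω - c)}
        ∪ {ω | ε * n ≤ ∑ j ∈ Finset.range n, -(U j ω - c)}) := by
        refine measureReal_mono ?_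
        intro ω hω
        simp only [Set.mem_ofPred_eq, Set.mem_union, Finset.sum_neg_distrib, Finset.sum_sub_distrib,
          Finset.sum_const, Finset.card_range, nsmul_eq_mul] at hω ⊢
        rcases lt_abs.mp hω with h | h
        · exact Or.inl h.le
        · exact Or.inr h.le
    _ ≤ _ := measureReal_union_le _ _
    _ ≤ _ := by linarith

/-- A law of large numbers that is uniform over a number of sequences growing quadratically with
the length of the averages. -/
theorem ae_eventually_abs_sum_sub_le [IsProbabilityMeasure P] {U : ℕ → ℕ → Ω → ℝ} {C c : ℝ}
    (hC : 0 < C)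
    (hind : ∀ i, iIndepFun (U i) P) (hmeas : ∀ i j, Measurable (U i j))
    (hb : ∀ i j, ∀ᵐ ω ∂P, |U i j ω| ≤ C) (hmean : ∀ i j, ∫ ω, U i j ω ∂P = c) :
    ∀ᵐ ω ∂P, ∀ ε : ℝ, 0 < ε → ∀ᶠ n : ℕ in atTop, ∀ i < n ^ 2,
      |∑ j ∈ Finset.range n, U i j ω - n * c| ≤ ε * n := by
  have key : ∀ ε : ℝ, 0 < ε → ∀ᵐ ω ∂P, ∀ᶠ n : ℕ in atTop, ∀ i < n ^ 2,
      |∑ j ∈ Finset.range n, U i j ω - n * c| ≤ ε * n := by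
    intro ε hε
    let B : ℕ → Set Ω := fun n =>
      ⋃ i ∈ Finset.range (n ^ 2), {ω | ε * n < |∑ j ∈ Finset.range n, U i j ω - n * c|}
    have hB : ∀ n, P.real (B n) ≤ 2 * ((n : ℝ) ^ 2 * Real.exp (-(ε ^ 2 / (2 * C ^ 2) * n))) := by
      intro n
      calc P.real (B n) ≤ ∑ i ∈ Finset.range (n ^ 2),
            P.real {ω | ε * n < |∑ j ∈ Finset.range n, U i j ω - n * c|} :=
            measureReal_biUnion_finset_le _ _
        _ ≤ ∑ i ∈ Finset.range (n ^ 2), 2 * Real.exp (-(ε ^ 2 / (2 * C ^ 2) * n)) :=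
            Finset.sum_le_sum fun i _ => measureReal_lt_abs_sum_sub_le hC hε.le (hind i)
              (hmeas i) (hb i) (hmean i) n
        _ = _ := by
            rw [Finset.sum_const, Finset.card_range, nsmul_eq_mul]
            push_cast
            ring
    have hsum : Summable fun n => P.real (B n) := by
      refine Summable.of_nonneg_of_le (fun _ => measureReal_nonneg) hB (Summable.mul_left 2 ?_)
      have := Real.summable_pow_mul_exp_neg_nat_mul 2 (r := ε ^ 2 / (2 * C ^ 2)) (by positivity)
      simpa [neg_mul] using this
    have hfin : ∑' n, P (B n) ≠ ⊤ := by
      have : ∀ n, P (B n) = ENNReal.ofReal (P.real (B n)) := fun n => by simp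
      simp_rw [this]
      exact hsum.tsum_ofReal_ne_top
    filter_upwards [ae_eventually_notMem hfin] with ω hω
    filter_upwards [hω] with n hn i hi
    by_contra! hcon
    exact hn (Set.mem_biUnion (Finset.mem_coe.mpr (Finset.mem_range.mpr hi)) hcon)
  have hall : ∀ᵐ ω ∂P, ∀ r : ℕ, ∀ᶠ n : ℕ in atTop, ∀ i < n ^ 2,
      |∑ j ∈ Finset.range n, U i j ω - n * c| ≤ 1 / ((r : ℝ) + 1) * n :=
    ae_all_iff.mpr fun r => key _ (by positivity)
  filter_upwards [hall] with ω hω ε hε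
  obtain ⟨r, hr⟩ := exists_nat_one_div_lt hε
  filter_upwards [hω r] with n hn i hi
  exact (hn i hi).trans (mul_le_mul_of_nonneg_right hr.le n.cast_nonneg)

end Probability

/-! ### Contractions in a weighted `ℓ¹` norm -/

/-- Banach's fixed point theorem for a self-map of `ℝ^ι` that contracts a weighted `ℓ¹` norm. -/
theorem exists_fixedPoint_of_weighted_contraction {ι : Type*} [Fintype ι] {w : ι → ℝ}
    (hw : ∀ i, 0 < w i) {κ : ℝ} (hκ : 0 ≤ κ) (hκ1 : κ < 1) (T : (ι → ℝ) → ι → ℝ)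
    (hT : ∀ x y, ∑ i, w i * |T x i - T y i| ≤ κ * ∑ i, w i * |x i - y i|) :
    ∃ x, T x = x := by
  -- rescaling the coordinates by `w` turns the weighted norm into the standard `ℓ¹` norm
  let S : PiLp 1 (fun _ : ι => ℝ) → PiLp 1 (fun _ : ι => ℝ) := fun x =>
    WithLp.toLp 1 fun i => w i * T (fun i => x i / w i) i
  have hS : ContractingWith ⟨κ, hκ⟩ S := by
    refine ⟨by exact_mod_cast hκ1, LipschitzWith.of_dist_le_mul fun x y => ?_⟩
    rw [PiLp.dist_eq_of_L1, PiLp.dist_eq_of_L1]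
    have hl : ∀ i, dist (S x i) (S y i)
        = w i * |T (fun i => x i / w i) i - T (fun i => y i / w i) i| := fun i => by
      rw [Real.dist_eq, show S x i - S y i
        = w i * (T (fun i => x i / w i) i - T (fun i => y i / w i) i) by simp [S, mul_sub],
        abs_mul, abs_of_pos (hw i)]
    have hr : ∀ i, dist (x i) (y i) = w i * |x i / w i - y i / w i| := fun i => by
      rw [Real.dist_eq, ← sub_div, abs_div, abs_of_pos (hw i)]
      have := (hw i).ne'
      field_simp
    simp_rw [hl, hr]
    exact hT _ _
  obtain ⟨x, hx, -⟩ := hS.exists_fixedPoint (0 : PiLp 1 (fun _ : ι => ℝ)) (by simp)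
  refine ⟨fun i => x i / w i, funext fun i => ?_⟩
  have hxi : w i * T (fun i => x i / w i) i = x i := congrArg (fun z : PiLp 1 _ => z i) hx
  rw [← hxi]
  have := (hw i).ne'
  field_simp

/-! ### The finite systems -/

/-- The small nodes of the system with group sizes `s`. -/
def nodes (s : Fin 2 → ℕ) : Finset Node :=
  (Finset.univ.sigma fun m => Finset.range (s m)).map
    (Equiv.sigmaEquivProd (Fin 2) ℕ).toEmbedding

theorem mem_nodes {s : Fin 2 → ℕ} {i : Node} : i ∈ nodes s ↔ i.2 < s i.1 := by
  simp [nodes, Equiv.sigmaEquivProd, Finset.mem_map_equiv]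

theorem sum_nodes (s : Fin 2 → ℕ) (g : Node → ℝ) :
    ∑ i ∈ nodes s, g i = ∑ m, ∑ j ∈ Finset.range (s m), g (m, j) := by
  rw [nodes, Finset.sum_map, Finset.sum_sigma]
  rfl

namespace Model

variable {Ω 𝒢 : Type*} (M : Model Ω 𝒢)

/-- The fraction of the small nodes that belongs to group `m`. -/
noncomputable def frac (m : Fin 2) : ℝ := if m = 0 then M.gam else 1 - M.gam

/-- The probability of an edge from a node of group `m'` to a node of group `m`. -/
noncomputable def edgeProb (m' m : Fin 2) : ℝ := if m = m' then M.p m' else M.pc m'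

/-- The part of the total weight of the node `j` that is directed to group `m`. -/
noncomputable def share (ω : Ω) (j : Node) (m : Fin 2) : ℝ :=
  if m = j.1 then (1 - M.etaSB j ω) * M.lam j.1 else (1 - M.lam j.1) * M.crossInd j.1

theorem W_eq (s : Fin 2 → ℕ) (ω : Ω) (j i : Node) :
    M.W s ω j i
      = M.I j i ω * M.share ω j i.1 / ∑ i' ∈ Finset.range (s i.1), M.I j (i.1, i') ω := by
  unfold W share
  split_ifs with h
  · rw [h, mul_assoc]
  · ring

/-- The performances that result from the aggregates of the performances `X`: fixed points of
`sysMap` are fixed points of this map, with the performance of the big node eliminated. -/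
noncomputable def response (s : Fin 2 → ℕ) (ω : Ω) (X : Node → ℝ) (i : Node) : ℝ :=
  M.xi ω i (M.agg s ω X i 0) (M.agg s ω X i 1) (M.fb (M.aggBig s ω X))

/-- The realization `ω` satisfies the pointwise parts of the assumptions. -/
structure IsRegular (sig vsig etaLow : ℝ) (ω : Ω) : Prop where
  lam_nonneg : ∀ m, 0 ≤ M.lam m
  lam_le_one : ∀ m, M.lam m ≤ 1
  I_eq : ∀ j i, M.I j i ω = 0 ∨ M.I j i ω = 1
  etaSB_mem : ∀ j, M.etaSB j ω ∈ Set.Icc (0 : ℝ) 1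
  le_etaSB : ∀ j, etaLow ≤ M.etaSB j ω
  etaLow_nonneg : 0 ≤ etaLow
  sig_nonneg : 0 ≤ sig
  sig_le_one : sig ≤ 1
  vsig_nonneg : 0 ≤ vsig
  vsig_le_one : vsig ≤ 1
  lipschitz_xi : ∀ j x₁ x₂ xb u₁ u₂ ub,
    |M.xi ω j x₁ x₂ xb - M.xi ω j u₁ u₂ ub| ≤ sig * (|x₁ - u₁| + |x₂ - u₂| + vsig * |xb - ub|)
  lipschitz_fb : ∀ x u : ℝ, |M.fb x - M.fb u| ≤ |x - u|

theorem crossInd_nonneg (m : Fin 2) : 0 ≤ M.crossInd m := by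
  unfold crossInd; split_ifs <;> norm_num

theorem crossInd_le_one (m : Fin 2) : M.crossInd m ≤ 1 := by
  unfold crossInd; split_ifs <;> norm_num

/-- The contraction constant of the network in the averaged `ℓ¹` norm. -/
noncomputable def kappa (sig vsig etaLow : ℝ) : ℝ :=
  sig * (1 - min (M.lam 0) (M.lam 1) * etaLow * (1 - vsig))

variable {M} in
theorem min_lam_le (m : Fin 2) : min (M.lam 0) (M.lam 1) ≤ M.lam m := by
  fin_cases m
  · exact min_le_left _ _
  · exact min_le_right _ _

variable {M} in
theorem kappa_nonneg {sig vsig etaLow : ℝ} (hsig : 0 ≤ sig) (hv : 0 ≤ vsig) (hv1 : vsig ≤ 1)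
    (he : 0 ≤ etaLow) (he1 : etaLow ≤ 1) (hlam : ∀ m, 0 ≤ M.lam m) (hlam1 : ∀ m, M.lam m ≤ 1) :
    0 ≤ M.kappa sig vsig etaLow := by
  have h0 : 0 ≤ min (M.lam 0) (M.lam 1) := le_min (hlam 0) (hlam 1)
  have h1 : min (M.lam 0) (M.lam 1) ≤ 1 := (min_lam_le 0).trans (hlam1 0)
  have h2 : min (M.lam 0) (M.lam 1) * etaLow ≤ 1 := mul_le_one₀ h1 he he1
  have h3 : min (M.lam 0) (M.lam 1) * etaLow * (1 - vsig) ≤ 1 :=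
    mul_le_one₀ h2 (by linarith) (by linarith)
  exact mul_nonneg hsig (by linarith)

variable {M} in
/-- The contraction condition stays valid when the lower bound on the share of the big node is
scaled down by the positive factors `lam m`. -/
theorem kappa_lt_one {sig vsig etaLow : ℝ} (hsig : 0 ≤ sig) (hsig1 : sig ≤ 1) (hv1 : vsig ≤ 1)
    (he : 0 ≤ etaLow) (hlam : ∀ m, 0 < M.lam m)
    (hcontr : sig * (1 - etaLow + vsig * etaLow) < 1) :
    M.kappa sig vsig etaLow < 1 := by
  have h0 : 0 < min (M.lam 0) (M.lam 1) := lt_min (hlam 0) (hlam 1)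
  have h1 : 0 ≤ min (M.lam 0) (M.lam 1) * (etaLow * (1 - vsig)) :=
    mul_nonneg h0.le (mul_nonneg he (by linarith))
  unfold kappa
  -- for `sig < 1` the factor `sig` is enough; for `sig = 1` the condition gives a strict gain
  rcases hsig1.lt_or_eq with h | rfl
  · nlinarith
  · have h2 : 0 < etaLow * (1 - vsig) := by linarith
    nlinarith [mul_pos h0 h2]

namespace IsRegular

variable {M} {sig vsig etaLow : ℝ} {ω : Ω}

theorem I_mem (h : M.IsRegular sig vsig etaLow ω) (j i : Node) :
    M.I j i ω ∈ Set.Icc (0 : ℝ) 1 := by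
  rcases h.I_eq j i with h | h <;> rw [h] <;> norm_num

theorem share_mem (h : M.IsRegular sig vsig etaLow ω) (j : Node) (m : Fin 2) :
    M.share ω j m ∈ Set.Icc (0 : ℝ) 1 := by
  have h0 := h.lam_nonneg j.1
  have h1 := h.lam_le_one j.1
  obtain ⟨h2, h3⟩ := h.etaSB_mem j
  unfold share
  split_ifs
  · exact ⟨mul_nonneg (by linarith) h0, mul_le_one₀ (by linarith) h0 h1⟩
  · exact ⟨mul_nonneg (by linarith) (M.crossInd_nonneg _),
      mul_le_one₀ (by linarith) (M.crossInd_nonneg _) (M.crossInd_le_one _)⟩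

theorem sum_share_le (h : M.IsRegular sig vsig etaLow ω) (j : Node) :
    ∑ m, M.share ω j m ≤ 1 - M.lam j.1 * M.etaSB j ω := by
  have h1 := h.lam_le_one j.1
  have h2 := M.crossInd_le_one j.1
  have h3 : (1 - M.lam j.1) * M.crossInd j.1 ≤ 1 - M.lam j.1 :=
    mul_le_of_le_one_right (by linarith) h2
  obtain ⟨m, j⟩ := j
  rw [Fin.sum_univ_two]
  fin_cases m <;> simp [share] at h3 ⊢ <;> linarith

theorem sum_I_nonneg (h : M.IsRegular sig vsig etaLow ω) (s : Fin 2 → ℕ) (j : Node) (m : Fin 2) :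
    0 ≤ ∑ i ∈ Finset.range (s m), M.I j (m, i) ω :=
  Finset.sum_nonneg fun i _ => (h.I_mem j (m, i)).1

theorem W_nonneg (h : M.IsRegular sig vsig etaLow ω) (s : Fin 2 → ℕ) (j i : Node) :
    0 ≤ M.W s ω j i := by
  rw [W_eq]
  exact div_nonneg (mul_nonneg (h.I_mem j i).1 (h.share_mem j i.1).1) (h.sum_I_nonneg s j i.1)

/-- The total weight that a node directs to the small nodes. An inequality, because a node without
any edge into a group loses the share meant for that group. -/
theorem sum_W_le (h : M.IsRegular sig vsig etaLow ω) (s : Fin 2 → ℕ) (j : Node) :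
    ∑ i ∈ nodes s, M.W s ω j i ≤ 1 - M.lam j.1 * M.etaSB j ω := by
  refine le_trans ?_ (h.sum_share_le j)
  rw [sum_nodes]
  refine Finset.sum_le_sum fun m _ => ?_
  simp_rw [W_eq]
  rw [← Finset.sum_div, ← Finset.sum_mul, mul_comm, mul_div_assoc]
  exact mul_le_of_le_one_right (h.share_mem j m).1 (div_self_le_one _)

theorem abs_agg_sub_le (h : M.IsRegular sig vsig etaLow ω) (s : Fin 2 → ℕ) (X Y : Node → ℝ)
    (i : Node) (m' : Fin 2) :
    |M.agg s ω X i m' - M.agg s ω Y i m'|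
      ≤ ∑ j ∈ Finset.range (s m'), |X (m', j) - Y (m', j)| * M.W s ω (m', j) i := by
  unfold agg
  rw [← Finset.sum_sub_distrib]
  refine (Finset.abs_sum_le_sum_abs _ _).trans (Finset.sum_le_sum fun j _ => ?_)
  rw [← sub_mul, abs_mul, abs_of_nonneg (h.W_nonneg s _ i)]

theorem sum_abs_agg_sub_le (h : M.IsRegular sig vsig etaLow ω) (s : Fin 2 → ℕ) (X Y : Node → ℝ) :
    ∑ i ∈ nodes s, (|M.agg s ω X i 0 - M.agg s ω Y i 0| + |M.agg s ω X i 1 - M.agg s ω Y i 1|)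
      ≤ ∑ j ∈ nodes s, |X j - Y j| * (1 - M.lam j.1 * M.etaSB j ω) := by
  calc _ ≤ ∑ i ∈ nodes s, ∑ j ∈ nodes s, |X j - Y j| * M.W s ω j i := by
        refine Finset.sum_le_sum fun i _ => ?_
        rw [sum_nodes, Fin.sum_univ_two]
        exact add_le_add (h.abs_agg_sub_le s X Y i 0) (h.abs_agg_sub_le s X Y i 1)
    _ = ∑ j ∈ nodes s, |X j - Y j| * ∑ i ∈ nodes s, M.W s ω j i := by
        rw [Finset.sum_comm]
        simp_rw [Finset.mul_sum]
    _ ≤ _ := Finset.sum_le_sum fun j _ =>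
        mul_le_mul_of_nonneg_left (h.sum_W_le s j) (abs_nonneg _)

theorem size_mul_abs_aggBig_sub_le (h : M.IsRegular sig vsig etaLow ω) (s : Fin 2 → ℕ)
    (X Y : Node → ℝ) :
    ((s 0 : ℝ) + s 1) * |M.aggBig s ω X - M.aggBig s ω Y|
      ≤ ∑ j ∈ nodes s, |X j - Y j| * (M.lam j.1 * M.etaSB j ω) := by
  have heq : M.aggBig s ω X - M.aggBig s ω Y
      = 1 / ((s 0 : ℝ) + s 1) * ∑ j ∈ nodes s, (X j - Y j) * (M.lam j.1 * M.etaSB j ω) := by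
    rw [sum_nodes, Fin.sum_univ_two]
    simp only [aggBig, Wb, sub_mul, Finset.sum_sub_distrib, mul_comm (M.etaSB _ _)]
    ring
  have hn : (0 : ℝ) ≤ (s 0 : ℝ) + s 1 := by positivity
  rw [heq, abs_mul, abs_of_nonneg (by positivity : 0 ≤ 1 / ((s 0 : ℝ) + s 1)), ← mul_assoc]
  have h1 : ((s 0 : ℝ) + s 1) * (1 / ((s 0 : ℝ) + s 1)) ≤ 1 := by
    rw [mul_one_div]; exact div_self_le_one _
  refine (mul_le_of_le_one_left (abs_nonneg _) h1).trans ?_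
  refine (Finset.abs_sum_le_sum_abs _ _).trans (Finset.sum_le_sum fun j _ => ?_)
  rw [abs_mul, abs_of_nonneg (mul_nonneg (h.lam_nonneg _) (h.etaSB_mem j).1)]

/-- Comparison of the response to `X` with the response to prescribed aggregates `u`, `ub`. -/
theorem sum_abs_response_sub_le (h : M.IsRegular sig vsig etaLow ω) (s : Fin 2 → ℕ)
    (X : Node → ℝ) (u : Node → Fin 2 → ℝ) (ub : ℝ) :
    ∑ i ∈ nodes s, |M.response s ω X i - M.xi ω i (u i 0) (u i 1) (M.fb ub)|
      ≤ sig * (∑ i ∈ nodes s, (|M.agg s ω X i 0 - u i 0| + |M.agg s ω X i 1 - u i 1|)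
        + vsig * (((s 0 : ℝ) + s 1) * |M.aggBig s ω X - ub|)) := by
  calc _ ≤ ∑ i ∈ nodes s, sig * (|M.agg s ω X i 0 - u i 0| + |M.agg s ω X i 1 - u i 1|
          + vsig * |M.aggBig s ω X - ub|) := by
        refine Finset.sum_le_sum fun i _ => (h.lipschitz_xi i _ _ _ _ _ _).trans ?_
        refine mul_le_mul_of_nonneg_left ?_ h.sig_nonneg
        have := mul_le_mul_of_nonneg_left (h.lipschitz_fb (M.aggBig s ω X) ub) h.vsig_nonneg
        linarith
    _ = _ := by
        rw [← Finset.mul_sum, Finset.sum_add_distrib]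
        congr 2
        rw [sum_nodes, Fin.sum_univ_two]
        simp only [Finset.sum_const, Finset.card_range, nsmul_eq_mul]
        ring

theorem lam_mul_etaSB_bound (h : M.IsRegular sig vsig etaLow ω) (j : Node) :
    1 - M.lam j.1 * M.etaSB j ω + vsig * (M.lam j.1 * M.etaSB j ω)
      ≤ 1 - min (M.lam 0) (M.lam 1) * etaLow * (1 - vsig) := by
  have h1 : min (M.lam 0) (M.lam 1) * etaLow ≤ M.lam j.1 * M.etaSB j ω :=
    mul_le_mul (min_lam_le _) (h.le_etaSB j) h.etaLow_nonneg (h.lam_nonneg _)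
  have h2 := mul_le_mul_of_nonneg_right h1 (sub_nonneg.mpr h.vsig_le_one)
  linarith

/-- The response map contracts the `ℓ¹` norm: a node spreads the weight at most
`1 - lam * etaSB` over the small nodes, and its influence through the big node is `lam * etaSB`
damped by the factor `vsig`. -/
theorem sum_abs_response_sub_response_le (h : M.IsRegular sig vsig etaLow ω) (s : Fin 2 → ℕ)
    (X Y : Node → ℝ) :
    ∑ i ∈ nodes s, |M.response s ω X i - M.response s ω Y i|
      ≤ M.kappa sig vsig etaLow * ∑ i ∈ nodes s, |X i - Y i| := by
  refine (h.sum_abs_response_sub_le s X (M.agg s ω Y) (M.aggBig s ω Y)).trans ?_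
  rw [kappa, mul_assoc]
  refine mul_le_mul_of_nonneg_left ?_ h.sig_nonneg
  have h1 := h.sum_abs_agg_sub_le s X Y
  have h2 := mul_le_mul_of_nonneg_left (h.size_mul_abs_aggBig_sub_le s X Y) h.vsig_nonneg
  refine (add_le_add h1 h2).trans ?_
  rw [Finset.mul_sum, Finset.mul_sum, ← Finset.sum_add_distrib]
  refine Finset.sum_le_sum fun j _ => ?_
  have := mul_le_mul_of_nonneg_left (h.lam_mul_etaSB_bound j) (abs_nonneg (X j - Y j))
  linarith

theorem etaLow_le_one (h : M.IsRegular sig vsig etaLow ω) : etaLow ≤ 1 :=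
  (h.le_etaSB (0, 0)).trans (h.etaSB_mem (0, 0)).2

theorem kappa_nonneg (h : M.IsRegular sig vsig etaLow ω) : 0 ≤ M.kappa sig vsig etaLow :=
  Model.kappa_nonneg h.sig_nonneg h.vsig_nonneg h.vsig_le_one h.etaLow_nonneg h.etaLow_le_one
    h.lam_nonneg h.lam_le_one

end IsRegular

theorem isFixedPt_sysMap_iff {s : Fin 2 → ℕ} {ω : Ω} {X : ℝ × (Node → ℝ)} :
    Function.IsFixedPt (M.sysMap s ω) X ↔
      X.1 = M.fb (M.aggBig s ω X.2) ∧
        ∀ i, X.2 i = if i.2 < s i.1 then M.response s ω X.2 i else 0 := by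
  obtain ⟨b, X⟩ := X
  simp only [Function.IsFixedPt, sysMap, Prod.mk.injEq, funext_iff, response]
  constructor
  · rintro ⟨rfl, h⟩
    exact ⟨rfl, fun i => (h i).symm⟩
  · rintro ⟨rfl, h⟩
    exact ⟨rfl, fun i => (h i).symm⟩

theorem agg_congr {s : Fin 2 → ℕ} {ω : Ω} {X Y : Node → ℝ}
    (h : ∀ i : Node, i.2 < s i.1 → X i = Y i) :
    M.agg s ω X = M.agg s ω Y := by
  funext i m'
  exact Finset.sum_congr rfl fun j hj => by rw [h (m', j) (Finset.mem_range.mp hj)]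

theorem aggBig_congr {s : Fin 2 → ℕ} {ω : Ω} {X Y : Node → ℝ}
    (h : ∀ i : Node, i.2 < s i.1 → X i = Y i) :
    M.aggBig s ω X = M.aggBig s ω Y := by
  unfold aggBig
  congr 2 <;>
  exact Finset.sum_congr rfl fun j hj => by rw [h (_, j) (Finset.mem_range.mp hj)]

variable {M}

theorem IsRegular.exists_isFixedPt_sysMap {sig vsig etaLow : ℝ} {ω : Ω}
    (h : M.IsRegular sig vsig etaLow ω) (hκ : M.kappa sig vsig etaLow < 1) (s : Fin 2 → ℕ) :
    ∃ X, Function.IsFixedPt (M.sysMap s ω) X := by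
  classical
  let ext : (nodes s → ℝ) → Node → ℝ := fun x i => if hi : i ∈ nodes s then x ⟨i, hi⟩ else 0
  have hext : ∀ x (i : nodes s), ext x i = x i := fun x i => dif_pos i.2
  obtain ⟨x, hx⟩ := exists_fixedPoint_of_weighted_contraction (w := fun _ => 1)
    (fun _ => one_pos) h.kappa_nonneg hκ (fun (x : nodes s → ℝ) i => M.response s ω (ext x) i) (by
      intro x y
      have := h.sum_abs_response_sub_response_le s (ext x) (ext y)
      rw [← Finset.sum_coe_sort, ← Finset.sum_coe_sort (nodes s) fun i => |ext x i - ext y i|]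
        at this
      simpa only [one_mul, hext] using this)
  refine ⟨(M.fb (M.aggBig s ω (ext x)), ext x), (M.isFixedPt_sysMap_iff).mpr ⟨rfl, fun i => ?_⟩⟩
  by_cases hi : i ∈ nodes s
  · rw [if_pos (mem_nodes.mp hi)]
    have := congrFun hx ⟨i, hi⟩
    exact (hext x ⟨i, hi⟩).trans this.symm
  · rw [if_neg (fun h => hi (mem_nodes.mpr h))]
    exact dif_neg hi

/-- Aggregates that are fixed by the aggregate map are the aggregates of a fixed point of the
original system. -/
theorem exists_isFixedPt_sysMap_of_aggMap {s : Fin 2 → ℕ} {ω : Ω}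
    {Z : ℝ × (Node → Fin 2 → ℝ)} (hZ : Function.IsFixedPt (M.aggMap s ω) Z) :
    ∃ X, Function.IsFixedPt (M.sysMap s ω) X ∧ Z.1 = M.aggBig s ω X.2 ∧
      ∀ i : Node, i.2 < s i.1 → Z.2 i = M.agg s ω X.2 i := by
  set Y : Node → ℝ := fun j => M.xi ω j (Z.2 j 0) (Z.2 j 1) (M.fb Z.1) with hY
  let X : Node → ℝ := fun j => if j.2 < s j.1 then Y j else 0
  have hXY : ∀ i : Node, i.2 < s i.1 → X i = Y i := fun i hi => if_pos hi
  have h1 : Z.1 = M.aggBig s ω X := by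
    rw [M.aggBig_congr hXY]
    exact (congrArg Prod.fst hZ).symm
  have h2 : ∀ i : Node, i.2 < s i.1 → Z.2 i = M.agg s ω X i := by
    intro i hi
    rw [M.agg_congr hXY]
    funext m'
    have := congrFun (congrFun (congrArg Prod.snd hZ) i) m'
    simp only [aggMap, if_pos hi] at this
    exact this.symm
  refine ⟨(M.fb (M.aggBig s ω X), X), M.isFixedPt_sysMap_iff.mpr ⟨rfl, fun i => ?_⟩, h1, h2⟩
  simp only [X]
  split_ifs with hi
  · change Y i = M.xi ω i (M.agg s ω X i 0) (M.agg s ω X i 1) (M.fb (M.aggBig s ω X))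
    rw [hY, ← h1, ← h2 i hi]
  · rfl

/-! ### Sizes and numbers of edges along the sequence of systems -/

section Deterministic

variable {Ω 𝒢 : Type*} {M : Model Ω 𝒢} {s : ℕ → Fin 2 → ℕ} {sig vsig etaLow : ℝ} {ω : Ω}

theorem frac_pos (h0 : 0 < M.gam) (h1 : M.gam < 1) (m : Fin 2) : 0 < M.frac m := by
  unfold frac
  split_ifs <;> linarith

theorem frac_add_frac : M.frac 0 + M.frac 1 = 1 := by simp [frac]

theorem IsSizeSequence.size_eq (hs : M.IsSizeSequence s) (k : ℕ) (m : Fin 2) :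
    (s k m : ℝ) = M.frac m * ((s k 0 : ℝ) + s k 1) := by
  have h0 := hs.size_zero k
  have h1 : (s k 1 : ℝ) = (1 - M.gam) * ((s k 0 : ℝ) + s k 1) := by linarith
  revert m
  rw [Fin.forall_fin_two]
  exact ⟨h0, h1⟩

theorem IsSizeSequence.tendsto_total (hs : M.IsSizeSequence s) :
    Tendsto (fun k => (s k 0 : ℝ) + s k 1) atTop atTop := by
  have := tendsto_natCast_atTop_atTop (R := ℝ) |>.comp hs.tendsto_size
  refine this.congr fun k => ?_
  simp

theorem IsSizeSequence.tendsto_group (hs : M.IsSizeSequence s) (hf : ∀ m, 0 < M.frac m)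
    (m : Fin 2) : Tendsto (fun k => s k m) atTop atTop := by
  rw [← tendsto_natCast_atTop_iff (R := ℝ)]
  exact (hs.tendsto_total.const_mul_atTop (hf m)).congr fun k => (hs.size_eq k m).symm

variable (M) in
/-- The summed deviation of the inverse numbers of edges from the nodes of group `m'` into group
`m`: the quantity that `AssumptionB2` requires to vanish in the limit. -/
noncomputable def degDev (s : Fin 2 → ℕ) (ω : Ω) (m' m : Fin 2) : ℝ :=
  ∑ j ∈ Finset.range (s m'),
    |1 / (∑ i ∈ Finset.range (s m), M.I (m', j) (m, i) ω) - 1 / ((s m : ℝ) * M.edgeProb m' m)|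

/-- A group that cannot be reached receives no share of the weight. -/
theorem share_eq_zero (hp : ∀ m, 0 < M.p m) {m' m : Fin 2} (h : ¬ 0 < M.edgeProb m' m) (j : ℕ) :
    M.share ω (m', j) m = 0 := by
  unfold edgeProb at h
  unfold share
  split_ifs at h ⊢ with h1
  · exact absurd (hp m') h
  · simp [crossInd, h]

theorem agg_eq_zero (hp : ∀ m, 0 < M.p m) {m' : Fin 2} {i : Node}
    (h : ¬ 0 < M.edgeProb m' i.1) (s : Fin 2 → ℕ) (X : Node → ℝ) : M.agg s ω X i m' = 0 :=
  Finset.sum_eq_zero fun j _ => by rw [W_eq, share_eq_zero hp h]; simp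

/-- Replacing the random numbers of edges by their means. -/
theorem IsRegular.abs_agg_sub_sum_le (h : M.IsRegular sig vsig etaLow ω) {s : Fin 2 → ℕ}
    {X : Node → ℝ} {C : ℝ} (hX : ∀ j, |X j| ≤ C) (i : Node) (m' : Fin 2) :
    |M.agg s ω X i m' - 1 / ((s i.1 : ℝ) * M.edgeProb m' i.1) *
        ∑ j ∈ Finset.range (s m'), X (m', j) * (M.I (m', j) i ω * M.share ω (m', j) i.1)|
      ≤ C * M.degDev s ω m' i.1 := by
  unfold agg degDev
  rw [Finset.mul_sum, Finset.mul_sum, ← Finset.sum_sub_distrib]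
  refine (Finset.abs_sum_le_sum_abs _ _).trans (Finset.sum_le_sum fun j _ => ?_)
  rw [W_eq]
  have hI := h.I_mem (m', j) i
  have hs := h.share_mem (m', j) i.1
  have h1 : M.I (m', j) i ω * M.share ω (m', j) i.1 ∈ Set.Icc (0 : ℝ) 1 :=
    ⟨mul_nonneg hI.1 hs.1, mul_le_one₀ hI.2 hs.1 hs.2⟩
  set D := ∑ i' ∈ Finset.range (s i.1), M.I (m', j) (i.1, i') ω
  set t := M.I (m', j) i ω * M.share ω (m', j) i.1
  have heq : X (m', j) * (t / D) - 1 / ((s i.1 : ℝ) * M.edgeProb m' i.1) * (X (m', j) * t)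
      = X (m', j) * (1 / D - 1 / ((s i.1 : ℝ) * M.edgeProb m' i.1)) * t := by ring
  rw [heq, abs_mul, abs_mul, abs_of_nonneg h1.1]
  exact (mul_le_of_le_one_right (by positivity) h1.2).trans
    (mul_le_mul_of_nonneg_right (hX _) (abs_nonneg _))

/-- The influence of a perturbation of the performances on the aggregate of a single node. -/
theorem IsRegular.abs_agg_sub_agg_le (h : M.IsRegular sig vsig etaLow ω) {s : Fin 2 → ℕ}
    {X Y : Node → ℝ} {C : ℝ} (i : Node) (m' : Fin 2)
    (hXY : ∀ j : Node, j.2 < s j.1 → |X j - Y j| ≤ C) (hq : 0 ≤ M.edgeProb m' i.1) :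
    |M.agg s ω X i m' - M.agg s ω Y i m'|
      ≤ C * M.degDev s ω m' i.1
        + 1 / ((s i.1 : ℝ) * M.edgeProb m' i.1) * ∑ j ∈ nodes s, |X j - Y j| := by
  have hpart : ∑ j ∈ Finset.range (s m'), |X (m', j) - Y (m', j)|
      ≤ ∑ j ∈ nodes s, |X j - Y j| := by
    rw [sum_nodes]
    exact Finset.single_le_sum (f := fun m => ∑ j ∈ Finset.range (s m), |X (m, j) - Y (m, j)|)
      (fun m _ => Finset.sum_nonneg fun _ _ => abs_nonneg _) (Finset.mem_univ m')
  have hw : 0 ≤ 1 / ((s i.1 : ℝ) * M.edgeProb m' i.1) := by positivity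
  refine (h.abs_agg_sub_le s X Y i m').trans
    (le_trans ?_ (add_le_add le_rfl (mul_le_mul_of_nonneg_left hpart hw)))
  rw [degDev, Finset.mul_sum, Finset.mul_sum, ← Finset.sum_add_distrib]
  refine Finset.sum_le_sum fun j hj => ?_
  have hI := h.I_mem (m', j) i
  have hs := h.share_mem (m', j) i.1
  have h1 : M.I (m', j) i ω * M.share ω (m', j) i.1 ≤ 1 := mul_le_one₀ hI.2 hs.1 hs.2
  have hD := h.sum_I_nonneg s (m', j) i.1
  rw [W_eq]
  set D := ∑ i' ∈ Finset.range (s i.1), M.I (m', j) (i.1, i') ω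
  set r := 1 / ((s i.1 : ℝ) * M.edgeProb m' i.1)
  have h2 : M.I (m', j) i ω * M.share ω (m', j) i.1 / D ≤ |1 / D - r| + r :=
    (div_le_div_of_nonneg_right h1 hD).trans (by linarith [le_abs_self (1 / D - r)])
  have h3 := hXY (m', j) (Finset.mem_range.mp hj)
  have h4 := mul_le_mul_of_nonneg_left h2 (abs_nonneg (X (m', j) - Y (m', j)))
  have h5 := mul_le_mul_of_nonneg_right h3 (abs_nonneg (1 / D - r))
  linarith

/-! ### Convergence of the fixed points from convergence of the frozen aggregates -/

/-- If the aggregates formed with the performances `xi ω j (x j.1 0) (x j.1 1) (fb xb)` converge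
to `x`, `xb`, then any fixed points are close to these performances on average. -/
theorem IsRegular.tendsto_average_sub (h : M.IsRegular sig vsig etaLow ω)
    (hκ : M.kappa sig vsig etaLow < 1) {xb : ℝ} {x : Fin 2 → Fin 2 → ℝ} {Y : Node → ℝ}
    (hY : ∀ j, Y j = M.xi ω j (x j.1 0) (x j.1 1) (M.fb xb))
    (hagg : ∀ ε > 0, ∀ᶠ k in atTop, ∀ i : Node, i.2 < s k i.1 →
      ∀ m', |M.agg (s k) ω Y i m' - x i.1 m'| ≤ ε)
    (hbig : Tendsto (fun k => M.aggBig (s k) ω Y) atTop (𝓝 xb))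
    {X : ℕ → Node → ℝ}
    (hX : ∀ k (i : Node), i.2 < s k i.1 → X k i = M.response (s k) ω (X k) i) :
    Tendsto (fun k => (∑ i ∈ nodes (s k), |X k i - Y i|) / ((s k 0 : ℝ) + s k 1))
      atTop (𝓝 0) := by
  rw [Metric.tendsto_nhds]
  intro δ hδ
  have hκ' : 0 < 1 - M.kappa sig vsig etaLow := by linarith
  have hε : 0 < (1 - M.kappa sig vsig etaLow) * (δ / 2) / 3 := by positivity
  set ε := (1 - M.kappa sig vsig etaLow) * (δ / 2) / 3 with hεdef
  filter_upwards [hagg ε hε, (Metric.tendsto_nhds.mp hbig) ε hε] with k h1 h2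
  rw [Real.dist_eq] at h2
  have hn : (0 : ℝ) ≤ (s k 0 : ℝ) + s k 1 := by positivity
  set D := ∑ i ∈ nodes (s k), |X k i - Y i| with hD
  have hD0 : 0 ≤ D := Finset.sum_nonneg fun _ _ => abs_nonneg _
  have h3 := h.sum_abs_response_sub_response_le (s k) (X k) Y
  have h4 := h.sum_abs_response_sub_le (s k) Y (fun i => x i.1) xb
  have h5 : ∑ i ∈ nodes (s k), (|M.agg (s k) ω Y i 0 - x i.1 0| + |M.agg (s k) ω Y i 1 - x i.1 1|)
      ≤ 2 * ε * ((s k 0 : ℝ) + s k 1) := by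
    calc _ ≤ ∑ i ∈ nodes (s k), 2 * ε := by
          refine Finset.sum_le_sum fun i hi => ?_
          linarith [h1 i (mem_nodes.mp hi) 0, h1 i (mem_nodes.mp hi) 1]
      _ = _ := by
          rw [sum_nodes, Fin.sum_univ_two]
          simp only [Finset.sum_const, Finset.card_range, nsmul_eq_mul]
          ring
  have h6 : vsig * (((s k 0 : ℝ) + s k 1) * |M.aggBig (s k) ω Y - xb|)
      ≤ ε * ((s k 0 : ℝ) + s k 1) := by
    refine (mul_le_of_le_one_left (by positivity) h.vsig_le_one).trans ?_
    rw [mul_comm]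
    exact mul_le_mul_of_nonneg_right h2.le hn
  have h7 : ∑ i ∈ nodes (s k), |M.response (s k) ω Y i - Y i|
      ≤ 3 * ε * ((s k 0 : ℝ) + s k 1) := by
    rw [Finset.sum_congr rfl fun i _ => by rw [hY i]]
    refine h4.trans ((mul_le_of_le_one_left ?_ h.sig_le_one).trans (by linarith))
    exact add_nonneg (Finset.sum_nonneg fun _ _ => by positivity)
      (mul_nonneg h.vsig_nonneg (by positivity))
  have h8 : D ≤ M.kappa sig vsig etaLow * D + 3 * ε * ((s k 0 : ℝ) + s k 1) := by
    refine le_trans ?_ (add_le_add h3 h7)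
    rw [← Finset.sum_add_distrib]
    refine Finset.sum_le_sum fun i hi => ?_
    rw [hX k i (mem_nodes.mp hi)]
    exact abs_sub_le _ _ _
  have h9 : D ≤ δ / 2 * ((s k 0 : ℝ) + s k 1) := by
    have : (1 - M.kappa sig vsig etaLow) * D
        ≤ (1 - M.kappa sig vsig etaLow) * (δ / 2 * ((s k 0 : ℝ) + s k 1)) := by
      rw [hεdef] at h8
      linarith
    exact le_of_mul_le_mul_left this hκ'
  rw [Real.dist_eq, sub_zero, abs_of_nonneg (div_nonneg hD0 hn)]
  exact (div_le_of_le_mul₀ hn (by positivity) h9).trans_lt (by linarith)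

theorem IsRegular.tendsto_aggBig (h : M.IsRegular sig vsig etaLow ω)
    (hs : M.IsSizeSequence s) {xb : ℝ} {Y : Node → ℝ}
    (hbig : Tendsto (fun k => M.aggBig (s k) ω Y) atTop (𝓝 xb)) {X : ℕ → Node → ℝ}
    (hD : Tendsto (fun k => (∑ i ∈ nodes (s k), |X k i - Y i|) / ((s k 0 : ℝ) + s k 1))
      atTop (𝓝 0)) :
    Tendsto (fun k => M.aggBig (s k) ω (X k)) atTop (𝓝 xb) := by
  have hdiff : Tendsto (fun k => M.aggBig (s k) ω (X k) - M.aggBig (s k) ω Y) atTop (𝓝 0) := by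
    refine squeeze_zero_norm' ?_ hD
    filter_upwards [hs.tendsto_total.eventually_gt_atTop 0] with k hk
    rw [Real.norm_eq_abs, le_div_iff₀ hk, mul_comm]
    refine (h.size_mul_abs_aggBig_sub_le (s k) (X k) Y).trans
      (Finset.sum_le_sum fun j _ => mul_le_of_le_one_right (abs_nonneg _) ?_)
    exact mul_le_one₀ (h.lam_le_one _) (h.etaSB_mem j).1 (h.etaSB_mem j).2
  simpa using hdiff.add hbig

theorem IsRegular.tendsto_agg (h : M.IsRegular sig vsig etaLow ω)
    (hs : M.IsSizeSequence s) (hf : ∀ m, 0 < M.frac m) (hp : ∀ m, 0 < M.p m)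
    (hdeg : ∀ m' m, 0 < M.edgeProb m' m →
      Tendsto (fun k => M.degDev (s k) ω m' m) atTop (𝓝 0))
    {x : Fin 2 → Fin 2 → ℝ} {Y : Node → ℝ}
    (hagg : ∀ ε > 0, ∀ᶠ k in atTop, ∀ i : Node, i.2 < s k i.1 →
      ∀ m', |M.agg (s k) ω Y i m' - x i.1 m'| ≤ ε)
    {X : ℕ → Node → ℝ} {C : ℝ} (hC : ∀ k (i : Node), i.2 < s k i.1 → |X k i - Y i| ≤ C)
    (hD : Tendsto (fun k => (∑ i ∈ nodes (s k), |X k i - Y i|) / ((s k 0 : ℝ) + s k 1))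
      atTop (𝓝 0)) (i : Node) (m' : Fin 2) :
    Tendsto (fun k => M.agg (s k) ω (X k) i m') atTop (𝓝 (x i.1 m')) := by
  -- a node belongs to all but finitely many of the systems
  have hY : Tendsto (fun k => M.agg (s k) ω Y i m') atTop (𝓝 (x i.1 m')) := by
    rw [Metric.tendsto_nhds]
    intro δ hδ
    filter_upwards [hagg (δ / 2) (by positivity),
      (hs.tendsto_group hf i.1).eventually_gt_atTop i.2] with k h1 h2
    rw [Real.dist_eq]
    linarith [h1 i h2 m']
  by_cases hq : 0 < M.edgeProb m' i.1
  · have hdiff : Tendsto (fun k => M.agg (s k) ω (X k) i m' - M.agg (s k) ω Y i m')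
        atTop (𝓝 0) := by
      have hlim := ((hdeg m' i.1 hq).const_mul C).add
        (hD.const_mul (1 / (M.frac i.1 * M.edgeProb m' i.1)))
      simp only [mul_zero, add_zero] at hlim
      refine squeeze_zero_norm (fun k => ?_) hlim
      refine (h.abs_agg_sub_agg_le i m' (hC k) hq.le).trans (le_of_eq ?_)
      rw [hs.size_eq k i.1]
      generalize (s k 0 : ℝ) + s k 1 = n
      ring
    simpa using hdiff.add hY
  · simpa only [agg_eq_zero hp hq] using hY

/-- The aggregates formed with performances `Y` that obey laws of large numbers converge,
uniformly over the nodes of the system. -/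
theorem IsRegular.eventually_abs_agg_sub_le (h : M.IsRegular sig vsig etaLow ω)
    (hs : M.IsSizeSequence s) (hf : ∀ m, 0 < M.frac m) (hp : ∀ m, 0 < M.p m)
    (hdeg : ∀ m' m, 0 < M.edgeProb m' m →
      Tendsto (fun k => M.degDev (s k) ω m' m) atTop (𝓝 0))
    {Y : Node → ℝ} {C : ℝ} (hC : ∀ j, |Y j| ≤ C) {c : Fin 2 → Fin 2 → ℝ}
    (hlln : ∀ m' m, ∀ ε : ℝ, 0 < ε → ∀ᶠ n : ℕ in atTop, ∀ i < n ^ 2,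
      |∑ j ∈ Finset.range n, Y (m', j) * (M.I (m', j) (m, i) ω * M.share ω (m', j) m)
        - n * (M.edgeProb m' m * c m' m)| ≤ ε * n)
    (hc : ∀ m' m, ¬ 0 < M.edgeProb m' m → c m' m = 0) (ε : ℝ) (hε : 0 < ε) :
    ∀ᶠ k in atTop, ∀ i : Node, i.2 < s k i.1 →
      ∀ m', |M.agg (s k) ω Y i m' - M.frac m' / M.frac i.1 * c m' i.1| ≤ ε := by
  suffices hmm : ∀ m' m, ∀ᶠ k in atTop, ∀ i < s k m,
      |M.agg (s k) ω Y (m, i) m' - M.frac m' / M.frac m * c m' m| ≤ ε by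
    have := eventually_all.mpr fun m' => eventually_all.mpr fun m => hmm m' m
    filter_upwards [this] with k hk i hi m' using hk m' i.1 i.2 hi
  intro m' m
  by_cases hq : 0 < M.edgeProb m' m
  · have hf' := hf m'
    have hfm := hf m
    have hε' : 0 < ε / 2 * (M.frac m * M.edgeProb m' m / M.frac m') := by positivity
    have hdev := ((hdeg m' m hq).const_mul C).eventually_le_const
      (show C * 0 < ε / 2 by rw [mul_zero]; positivity)
    have hsize := hs.tendsto_group hf m'
    filter_upwards [hdev, hsize.eventually (hlln m' m _ hε'),
      hs.tendsto_total.eventually_gt_atTop 0,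
      hs.tendsto_total.eventually_ge_atTop (M.frac m / M.frac m' ^ 2)] with k h1 h2 h3 h4 i hi
    -- the number of nodes of one group is at most the square of that of the other
    have hsq : s k m ≤ (s k m') ^ 2 := by
      have : (s k m : ℝ) ≤ (s k m' : ℝ) ^ 2 := by
        rw [hs.size_eq k m, hs.size_eq k m']
        rw [div_le_iff₀ (by positivity)] at h4
        nlinarith
      exact_mod_cast this
    have h5 := h2 i (hi.trans_le hsq)
    have h6 := h.abs_agg_sub_sum_le (s := s k) hC (m, i) m'
    set S := ∑ j ∈ Finset.range (s k m'),
      Y (m', j) * (M.I (m', j) (m, i) ω * M.share ω (m', j) m)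
    have h7 : |1 / ((s k m : ℝ) * M.edgeProb m' m) * S - M.frac m' / M.frac m * c m' m|
        ≤ ε / 2 := by
      have heq : 1 / ((s k m : ℝ) * M.edgeProb m' m) * S - M.frac m' / M.frac m * c m' m
          = 1 / ((s k m : ℝ) * M.edgeProb m' m)
            * (S - (s k m' : ℝ) * (M.edgeProb m' m * c m' m)) := by
        rw [hs.size_eq k m, hs.size_eq k m']
        field_simp
      have hpos : 0 < 1 / ((s k m : ℝ) * M.edgeProb m' m) := by
        rw [hs.size_eq k m]; positivity
      rw [heq, abs_mul, abs_of_pos hpos]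
      refine (mul_le_mul_of_nonneg_left h5 hpos.le).trans (le_of_eq ?_)
      rw [hs.size_eq k m, hs.size_eq k m']
      field_simp
    refine (abs_sub_le _ (1 / ((s k m : ℝ) * M.edgeProb m' m) * S) _).trans ?_
    exact (add_le_add (h6.trans h1) h7).trans (by linarith)
  · refine Eventually.of_forall fun k i _ => ?_
    rw [agg_eq_zero hp hq, hc m' m hq]
    simpa using hε.le

theorem tendsto_aggBig_of_lln (hs : M.IsSizeSequence s) (hf : ∀ m, 0 < M.frac m)
    {Y : Node → ℝ} {c : Fin 2 → ℝ}
    (hlln : ∀ m, ∀ ε : ℝ, 0 < ε → ∀ᶠ n : ℕ in atTop,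
      |∑ j ∈ Finset.range n, Y (m, j) * M.Wb ω (m, j) - n * c m| ≤ ε * n) :
    Tendsto (fun k => M.aggBig (s k) ω Y) atTop (𝓝 (∑ m, M.frac m * c m)) := by
  have hm : ∀ m, Tendsto (fun k => 1 / ((s k 0 : ℝ) + s k 1)
      * ∑ j ∈ Finset.range (s k m), Y (m, j) * M.Wb ω (m, j)) atTop (𝓝 (M.frac m * c m)) := by
    intro m
    rw [Metric.tendsto_nhds]
    intro δ hδ
    have hfm := hf m
    filter_upwards [(hs.tendsto_group hf m).eventually
      (hlln m (δ / 2 / M.frac m) (by positivity)),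
      hs.tendsto_total.eventually_gt_atTop 0] with k h1 h2
    rw [Real.dist_eq]
    have heq : 1 / ((s k 0 : ℝ) + s k 1)
        * ∑ j ∈ Finset.range (s k m), Y (m, j) * M.Wb ω (m, j) - M.frac m * c m
        = 1 / ((s k 0 : ℝ) + s k 1)
          * (∑ j ∈ Finset.range (s k m), Y (m, j) * M.Wb ω (m, j) - s k m * c m) := by
      rw [hs.size_eq k m]
      field_simp
    rw [heq, abs_mul, abs_of_pos (by positivity)]
    refine (mul_le_mul_of_nonneg_left h1 (by positivity)).trans_lt ?_
    rw [hs.size_eq k m]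
    field_simp
    linarith
  rw [Fin.sum_univ_two]
  exact (hm 0).add (hm 1)

end Deterministic

/-! ### Laws of large numbers for the frozen aggregates -/

section Stochastic

variable {Ω 𝒢 : Type*} [MeasurableSpace 𝒢] {M : Model Ω 𝒢}

/-- The σ-algebra generated by a set of primitive random variables. -/
@[reducible] def blockSigma (M : Model Ω 𝒢) (S : Set Source) : MeasurableSpace Ω :=
  ⨆ a ∈ S, M.sourceSigma a

theorem sourceSigma_le_blockSigma {S : Set Source} {a : Source} (ha : a ∈ S) :
    M.sourceSigma a ≤ M.blockSigma S :=
  le_biSup M.sourceSigma ha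

theorem measurable_I_blockSigma {S : Set Source} {j i : Node} (h : .edge j i ∈ S) :
    Measurable[M.blockSigma S] (M.I j i) :=
  (comap_measurable (M.I j i)).mono (sourceSigma_le_blockSigma (M := M) h) le_rfl

theorem measurable_xi_blockSigma {y : ℝ} (hB1 : M.AssumptionB1 y) {S : Set Source} {j : Node}
    (h1 : .shock j ∈ S) (h2 : .fromBig j ∈ S) (x₁ x₂ xb : ℝ) :
    Measurable[M.blockSigma S] fun ω => M.xi ω j x₁ x₂ xb := by
  have hG : Measurable[M.blockSigma S] (M.G j) :=
    (comap_measurable (M.G j)).mono (sourceSigma_le_blockSigma (M := M) h1) le_rfl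
  have he : Measurable[M.blockSigma S] (M.etaBS j) :=
    (comap_measurable (M.etaBS j)).mono (sourceSigma_le_blockSigma (M := M) h2) le_rfl
  exact (hB1.measurable_f j.1).comp
    (hG.prodMk (measurable_const.prodMk (measurable_const.prodMk (he.mul_const xb))))

theorem measurable_etaSB_blockSigma {S : Set Source} {j : Node} (h : .toBig j ∈ S) :
    Measurable[M.blockSigma S] (M.etaSB j) :=
  (comap_measurable (M.etaSB j)).mono (sourceSigma_le_blockSigma (M := M) h) le_rfl

theorem measurable_share_blockSigma {S : Set Source} {j : Node} (h : .toBig j ∈ S) (m : Fin 2) :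
    Measurable[M.blockSigma S] fun ω => M.share ω j m := by
  have he := measurable_etaSB_blockSigma (M := M) h
  unfold share
  split_ifs
  · exact (measurable_const.sub he).mul_const _
  · exact measurable_const

theorem measurable_Wb_blockSigma {S : Set Source} {j : Node} (h : .toBig j ∈ S) :
    Measurable[M.blockSigma S] fun ω => M.Wb ω j :=
  (measurable_etaSB_blockSigma (M := M) h).mul_const _

theorem AssumptionB1.abs_xi_le {y : ℝ} (hB1 : M.AssumptionB1 y) (ω : Ω) (j : Node)
    (x₁ x₂ xb : ℝ) : |M.xi ω j x₁ x₂ xb| ≤ y := by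
  have h : M.xi ω j x₁ x₂ xb ∈ Set.Icc 0 y := hB1.f_mem _ _ _ _ _
  rw [abs_of_nonneg h.1]
  exact h.2

variable [mΩ : MeasurableSpace Ω] {P : Measure Ω}

/-- The part of the weight of a node of group `m'` that is directed to group `m`, on average. -/
noncomputable def meanShare (M : Model Ω 𝒢) (P : Measure Ω) (m' m : Fin 2) : ℝ :=
  if m = m' then (1 - M.psb P m') * M.lam m' else (1 - M.lam m') * M.crossInd m'

theorem IsRandomNetwork.sourceSigma_le (hM : M.IsRandomNetwork P) (a : Source) :
    M.sourceSigma a ≤ mΩ := by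
  cases a with
  | edge j i => exact (hM.measurable_I j i).comap_le
  | shock j => exact (hM.measurable_G j).comap_le
  | toBig j => exact (hM.measurable_etaSB j).comap_le
  | fromBig j => exact (hM.measurable_etaBS j).comap_le

theorem IsRandomNetwork.blockSigma_le (hM : M.IsRandomNetwork P) (S : Set Source) :
    M.blockSigma S ≤ mΩ :=
  iSup₂_le fun a _ => hM.sourceSigma_le a

theorem IsRandomNetwork.indepFun (hM : M.IsRandomNetwork P) {S T : Set Source}
    (hST : Disjoint S T) {f g : Ω → ℝ} (hf : Measurable[M.blockSigma S] f)
    (hg : Measurable[M.blockSigma T] g) : IndepFun f g P := by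
  rw [IndepFun_iff_Indep]
  exact indep_of_indep_of_le_left (indep_of_indep_of_le_right
    (indep_iSup_of_disjoint hM.sourceSigma_le hM.indep hST) hg.comap_le) hf.comap_le

theorem IsRandomNetwork.integral_I (hM : M.IsRandomNetwork P) (m' m : Fin 2) (j i : ℕ) :
    ∫ ω, M.I (m', j) (m, i) ω ∂P = M.edgeProb m' m := by
  have hset : MeasurableSet {ω | M.I (m', j) (m, i) ω = 1} :=
    hM.measurable_I _ _ (measurableSet_singleton 1)
  have heq : M.I (m', j) (m, i) = {ω | M.I (m', j) (m, i) ω = 1}.indicator 1 := by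
    funext ω
    rcases hM.I_eq (m', j) (m, i) ω with h | h <;> simp [Set.indicator, h]
  have hP := hM.prob_I (m', j) (m, i)
  rw [heq, integral_indicator_one hset, hP]
  rfl

theorem IsRandomNetwork.integral_etaSB (hM : M.IsRandomNetwork P) (m : Fin 2) (j : ℕ) :
    ∫ ω, M.etaSB (m, j) ω ∂P = M.psb P m :=
  (hM.identDistrib_etaSB m j).integral_eq

variable [IsProbabilityMeasure P]

theorem IsRandomNetwork.iIndepFun (hM : M.IsRandomNetwork P) {S : ℕ → Set Source}
    (hS : Pairwise fun j k => Disjoint (S j) (S k)) {f : ℕ → Ω → ℝ}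
    (hf : ∀ j, Measurable[M.blockSigma (S j)] (f j)) : iIndepFun f P := by
  have h := iIndep_iSup_of_pairwise_disjoint hM.sourceSigma_le hM.indep hS
  rw [iIndepFun_iff_iIndep, iIndep_iff]
  rw [iIndep_iff] at h
  exact fun t A hA => h t fun j hj => (hf j).comap_le _ (hA j hj)

theorem IsRandomNetwork.integral_xi (hM : M.IsRandomNetwork P) {y : ℝ} (hB1 : M.AssumptionB1 y)
    (m : Fin 2) (j : ℕ) (x₁ x₂ xb : ℝ) :
    ∫ ω, M.xi ω (m, j) x₁ x₂ xb ∂P = M.meanXi P m x₁ x₂ xb := by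
  have hind : ∀ j, IndepFun (M.G (m, j)) (M.etaBS (m, j)) P := fun j => by
    rw [IndepFun_iff_Indep]
    exact hM.indep.indep (i := .shock (m, j)) (j := .fromBig (m, j)) (by simp)
  have hid := (hM.identDistrib_G m j).prodMk (hM.identDistrib_etaBS m j) (hind j) (hind 0)
  have hmeas : Measurable fun q : 𝒢 × ℝ => M.f m q.1 x₁ x₂ (q.2 * xb) :=
    (hB1.measurable_f m).comp (measurable_fst.prodMk
      (measurable_const.prodMk (measurable_const.prodMk (measurable_snd.mul_const xb))))
  exact (hid.comp hmeas).integral_eq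

theorem IsRandomNetwork.integrable_etaSB (hM : M.IsRandomNetwork P) (j : Node) :
    Integrable (M.etaSB j) P :=
  Integrable.of_mem_Icc 0 1 (hM.measurable_etaSB j).aemeasurable (hM.etaSB_mem j)

theorem IsRandomNetwork.integral_share (hM : M.IsRandomNetwork P) (m' m : Fin 2) (j : ℕ) :
    ∫ ω, M.share ω (m', j) m ∂P = M.meanShare P m' m := by
  unfold share meanShare
  split_ifs
  · rw [integral_mul_const, integral_sub (integrable_const _) (hM.integrable_etaSB _),
      hM.integral_etaSB]
    simp
  · simp

/-- The law of large numbers for the influence on the nodes of group `m` of the nodes of group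
`m'`, with the aggregates in their performances frozen. -/
theorem IsRandomNetwork.ae_lln_edge (hM : M.IsRandomNetwork P) {y : ℝ} (hB1 : M.AssumptionB1 y)
    (hreg : ∀ j, ∀ m, ∀ᵐ ω ∂P, M.share ω j m ∈ Set.Icc (0 : ℝ) 1)
    (m' m : Fin 2) (x₁ x₂ xb : ℝ) :
    ∀ᵐ ω ∂P, ∀ ε : ℝ, 0 < ε → ∀ᶠ n : ℕ in atTop, ∀ i < n ^ 2,
      |∑ j ∈ Finset.range n, M.xi ω (m', j) x₁ x₂ xb
          * (M.I (m', j) (m, i) ω * M.share ω (m', j) m)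
        - n * (M.edgeProb m' m * (M.meanShare P m' m * M.meanXi P m' x₁ x₂ xb))| ≤ ε * n := by
  have hy : 0 ≤ y := (hB1.fb_mem 0).1.trans (hB1.fb_mem 0).2
  refine ae_eventually_abs_sum_sub_le (C := y + 1) (U := fun i j ω =>
    M.xi ω (m', j) x₁ x₂ xb * (M.I (m', j) (m, i) ω * M.share ω (m', j) m)) (by linarith)
    ?_ ?_ ?_ ?_
  · intro i
    refine hM.iIndepFun (S := fun j => {.edge (m', j) (m, i), .shock (m', j), .toBig (m', j),
      .fromBig (m', j)}) ?_ ?_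
    · intro j k hjk
      simp [hjk.symm]
    · intro j
      exact (measurable_xi_blockSigma hB1 (by simp) (by simp) _ _ _).mul
        ((measurable_I_blockSigma (by simp)).mul (measurable_share_blockSigma (by simp) m))
  · intro i j
    have h := (measurable_xi_blockSigma (M := M) hB1 (S := Set.univ) (j := (m', j))
      (by simp) (by simp) x₁ x₂ xb).mul
        ((measurable_I_blockSigma (j := (m', j)) (i := (m, i)) (by simp)).mul
          (measurable_share_blockSigma (j := (m', j)) (by simp) m))
    exact h.mono (hM.blockSigma_le _) le_rfl
  · intro i j
    filter_upwards [hreg (m', j) m] with ω hω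
    rw [abs_mul]
    have h1 : |M.I (m', j) (m, i) ω * M.share ω (m', j) m| ≤ 1 := by
      rcases hM.I_eq (m', j) (m, i) ω with h | h <;> rw [h]
      · simp
      · rw [one_mul, abs_of_nonneg hω.1]; exact hω.2
    exact (mul_le_of_le_one_right (abs_nonneg _) h1).trans
      ((hB1.abs_xi_le ω _ _ _ _).trans (by linarith))
  · intro i j
    have hxi := measurable_xi_blockSigma (M := M) hB1 (j := (m', j))
      (S := {.shock (m', j), .fromBig (m', j)}) (by simp) (by simp) x₁ x₂ xb
    have hIs : Measurable[M.blockSigma {.edge (m', j) (m, i), .toBig (m', j)}]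
        fun ω => M.I (m', j) (m, i) ω * M.share ω (m', j) m :=
      (measurable_I_blockSigma (by simp)).mul (measurable_share_blockSigma (by simp) m)
    have hI := measurable_I_blockSigma (M := M) (j := (m', j)) (i := (m, i))
      (S := {.edge (m', j) (m, i)}) (by simp)
    have hs := measurable_share_blockSigma (M := M) (j := (m', j)) (S := {.toBig (m', j)})
      (by simp) m
    have hle := hM.blockSigma_le
    rw [(hM.indepFun (by simp) hxi hIs).integral_fun_mul_eq_mul_integral
        (hxi.mono (hle _) le_rfl).aestronglyMeasurable
        (hIs.mono (hle _) le_rfl).aestronglyMeasurable,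
      (hM.indepFun (by simp) hI hs).integral_fun_mul_eq_mul_integral
        (hI.mono (hle _) le_rfl).aestronglyMeasurable
        (hs.mono (hle _) le_rfl).aestronglyMeasurable,
      hM.integral_xi hB1, hM.integral_I, hM.integral_share]
    ring

/-- The law of large numbers for the influence of the nodes of group `m` on the big node, with the
aggregates in their performances frozen. -/
theorem IsRandomNetwork.ae_lln_big (hM : M.IsRandomNetwork P) {y : ℝ} (hB1 : M.AssumptionB1 y)
    (m : Fin 2) (x₁ x₂ xb : ℝ) :
    ∀ᵐ ω ∂P, ∀ ε : ℝ, 0 < ε → ∀ᶠ n : ℕ in atTop,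
      |∑ j ∈ Finset.range n, M.xi ω (m, j) x₁ x₂ xb * M.Wb ω (m, j)
        - n * (M.lam m * M.psb P m * M.meanXi P m x₁ x₂ xb)| ≤ ε * n := by
  have hy : 0 ≤ y := (hB1.fb_mem 0).1.trans (hB1.fb_mem 0).2
  have hle := hM.blockSigma_le
  have h := ae_eventually_abs_sum_sub_le (P := P) (C := y + 1)
    (c := M.lam m * M.psb P m * M.meanXi P m x₁ x₂ xb) (U := fun _ j ω =>
    M.xi ω (m, j) x₁ x₂ xb * M.Wb ω (m, j)) (by linarith) ?_ ?_ ?_ ?_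
  · filter_upwards [h] with ω hω ε hε
    filter_upwards [hω ε hε, eventually_gt_atTop 0] with n hn hn0
    exact hn 0 (by positivity)
  · intro _
    refine hM.iIndepFun (S := fun j => {.shock (m, j), .toBig (m, j), .fromBig (m, j)}) ?_ ?_
    · intro j k hjk
      simp [hjk.symm]
    · intro j
      exact (measurable_xi_blockSigma hB1 (by simp) (by simp) _ _ _).mul
        (measurable_Wb_blockSigma (by simp))
  · intro _ j
    have h := (measurable_xi_blockSigma (M := M) hB1 (S := Set.univ) (j := (m, j))
      (by simp) (by simp) x₁ x₂ xb).mul (measurable_Wb_blockSigma (j := (m, j)) (by simp))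
    exact h.mono (hle _) le_rfl
  · intro _ j
    filter_upwards [hM.etaSB_mem (m, j)] with ω hω
    rw [abs_mul]
    have h1 : |M.Wb ω (m, j)| ≤ 1 := by
      rw [Wb, abs_of_nonneg (mul_nonneg hω.1 (hM.lam_nonneg m))]
      exact mul_le_one₀ hω.2 (hM.lam_nonneg m) (hM.lam_le_one m)
    exact (mul_le_of_le_one_right (abs_nonneg _) h1).trans
      ((hB1.abs_xi_le ω _ _ _ _).trans (by linarith))
  · intro _ j
    have hxi := measurable_xi_blockSigma (M := M) hB1 (j := (m, j))
      (S := {.shock (m, j), .fromBig (m, j)}) (by simp) (by simp) x₁ x₂ xb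
    have hW := measurable_Wb_blockSigma (M := M) (j := (m, j)) (S := {.toBig (m, j)}) (by simp)
    rw [(hM.indepFun (by simp) hxi hW).integral_fun_mul_eq_mul_integral
        (hxi.mono (hle _) le_rfl).aestronglyMeasurable
        (hW.mono (hle _) le_rfl).aestronglyMeasurable, hM.integral_xi hB1]
    simp only [Wb]
    rw [integral_mul_const, hM.integral_etaSB]
    ring

end Stochastic

/-! ### The mean-field system -/

section MeanField

variable {Ω 𝒢 : Type*} [MeasurableSpace Ω] {P : Measure Ω} {M : Model Ω 𝒢}

/-- The aggregate that a node of group `m` receives from group `m'` when `a` gives the mean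
performances of the groups. -/
noncomputable def limAgg (M : Model Ω 𝒢) (P : Measure Ω) (a : Fin 2 → ℝ) (m m' : Fin 2) : ℝ :=
  M.frac m' / M.frac m * (M.meanShare P m' m * a m')

/-- The aggregate that the big node receives when `a` gives the mean performances of the groups. -/
noncomputable def limBig (M : Model Ω 𝒢) (P : Measure Ω) (a : Fin 2 → ℝ) : ℝ :=
  ∑ m, M.frac m * (M.lam m * M.psb P m * a m)

/-- The mean performances that result from the mean performances `a`. Its fixed points correspond
to those of `threeDimMap`. -/
noncomputable def meanResponse (M : Model Ω 𝒢) (P : Measure Ω) (a : Fin 2 → ℝ) (m : Fin 2) : ℝ :=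
  M.meanXi P m (M.limAgg P a m 0) (M.limAgg P a m 1) (M.fb (M.limBig P a))

theorem meanShare_eq_zero (hp : ∀ m, 0 < M.p m) {m' m : Fin 2} (h : ¬ 0 < M.edgeProb m' m) :
    M.meanShare P m' m = 0 := by
  unfold edgeProb at h
  unfold meanShare
  split_ifs at h ⊢ with h1
  · exact absurd (hp m') h
  · simp [crossInd, h]

theorem sum_meanShare_le (hlam : ∀ m, M.lam m ≤ 1) (m' : Fin 2) :
    M.meanShare P m' 0 + M.meanShare P m' 1 ≤ 1 - M.lam m' * M.psb P m' := by
  have h : (1 - M.lam m') * M.crossInd m' ≤ 1 - M.lam m' :=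
    mul_le_of_le_one_right (by linarith [hlam m']) (M.crossInd_le_one m')
  revert h
  revert m'
  rw [Fin.forall_fin_two]
  constructor <;> intro h <;> simp [meanShare] at h ⊢ <;> linarith

theorem meanShare_nonneg (hlam0 : ∀ m, 0 ≤ M.lam m) (hlam : ∀ m, M.lam m ≤ 1)
    (hpsb : ∀ m, M.psb P m ≤ 1) (m' m : Fin 2) : 0 ≤ M.meanShare P m' m := by
  unfold meanShare
  split_ifs
  · exact mul_nonneg (by linarith [hpsb m']) (hlam0 m')
  · exact mul_nonneg (by linarith [hlam m']) (M.crossInd_nonneg m')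

theorem IsRandomNetwork.le_psb [IsProbabilityMeasure P] [MeasurableSpace 𝒢]
    (hM : M.IsRandomNetwork P) {e : ℝ}
    (he : ∀ j, ∀ᵐ ω ∂P, e ≤ M.etaSB j ω) (m : Fin 2) : e ≤ M.psb P m := by
  have := integral_mono_ae (integrable_const e) (hM.integrable_etaSB (m, 0)) (he (m, 0))
  rw [integral_const, probReal_univ, one_smul] at this
  exact this

theorem abs_meanXi_sub_le [IsProbabilityMeasure P] [MeasurableSpace 𝒢]
    (hM : M.IsRandomNetwork P) {y sig vsig : ℝ} (hB1 : M.AssumptionB1 y)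
    (hB3 : M.AssumptionB3 P sig vsig) (m : Fin 2) (x₁ x₂ xb u₁ u₂ ub : ℝ) :
    |M.meanXi P m x₁ x₂ xb - M.meanXi P m u₁ u₂ ub|
      ≤ sig * (|x₁ - u₁| + |x₂ - u₂| + vsig * |xb - ub|) := by
  have hint : ∀ x₁ x₂ xb, Integrable (fun ω => M.xi ω (m, 0) x₁ x₂ xb) P := fun x₁ x₂ xb => by
    have hmeas := (measurable_xi_blockSigma (M := M) hB1 (S := Set.univ) (j := (m, 0))
      (by simp) (by simp) x₁ x₂ xb).mono (hM.blockSigma_le _) le_rfl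
    exact Integrable.of_mem_Icc 0 y hmeas.aemeasurable
      (Eventually.of_forall fun ω => hB1.f_mem _ _ _ _ _)
  unfold meanXi
  rw [← integral_sub (hint _ _ _) (hint _ _ _), ← Real.norm_eq_abs]
  have h := norm_integral_le_of_norm_le_const (μ := P)
    (f := fun ω => M.xi ω (m, 0) x₁ x₂ xb - M.xi ω (m, 0) u₁ u₂ ub)
    (C := sig * (|x₁ - u₁| + |x₂ - u₂| + vsig * |xb - ub|)) (by
      filter_upwards [hB3.lipschitz_xi (m, 0)] with ω hω
      exact hω _ _ _ _ _ _)
  simpa using h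

/-- The mean-field map contracts the `ℓ¹` norm weighted by the group sizes, with the same constant
as the finite systems. -/
theorem sum_abs_meanResponse_sub_le [IsProbabilityMeasure P] [MeasurableSpace 𝒢]
    (hM : M.IsRandomNetwork P) {y sig vsig etaLow : ℝ} (hB1 : M.AssumptionB1 y)
    (hB3 : M.AssumptionB3 P sig vsig) (he0 : 0 ≤ etaLow)
    (he : ∀ j, ∀ᵐ ω ∂P, etaLow ≤ M.etaSB j ω) (hpsb : ∀ m, M.psb P m < 1) (a b : Fin 2 → ℝ) :
    ∑ m, M.frac m * |M.meanResponse P a m - M.meanResponse P b m|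
      ≤ M.kappa sig vsig etaLow * ∑ m, M.frac m * |a m - b m| := by
  have hf := frac_pos hM.gam_pos hM.gam_lt_one
  have hshare := meanShare_nonneg (P := P) hM.lam_nonneg hM.lam_le_one fun m => (hpsb m).le
  have hpsb0 : ∀ m, 0 ≤ M.psb P m := fun m => he0.trans (hM.le_psb he m)
  have hbig : |M.fb (M.limBig P a) - M.fb (M.limBig P b)|
      ≤ ∑ m, M.frac m * |a m - b m| * (M.lam m * M.psb P m) := by
    refine (hB3.lipschitz_fb _ _).trans ?_
    rw [limBig, limBig, ← Finset.sum_sub_distrib]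
    refine (Finset.abs_sum_le_sum_abs _ _).trans (Finset.sum_le_sum fun m _ => le_of_eq ?_)
    rw [← mul_sub, ← mul_sub, abs_mul, abs_mul, abs_of_pos (hf m),
      abs_of_nonneg (mul_nonneg (hM.lam_nonneg m) (hpsb0 m))]
    ring
  have hagg : ∀ m m', M.frac m * |M.limAgg P a m m' - M.limAgg P b m m'|
      = M.frac m' * |a m' - b m'| * M.meanShare P m' m := fun m m' => by
    have h1 := hf m
    have h2 := hf m'
    rw [limAgg, limAgg, ← mul_sub, ← mul_sub, abs_mul, abs_mul, abs_of_pos (by positivity),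
      abs_of_nonneg (hshare m' m)]
    field_simp
  have hterm : ∀ m, M.frac m * |M.meanResponse P a m - M.meanResponse P b m|
      ≤ sig * (M.frac 0 * |a 0 - b 0| * M.meanShare P 0 m
        + M.frac 1 * |a 1 - b 1| * M.meanShare P 1 m
        + M.frac m * (vsig * ∑ m, M.frac m * |a m - b m| * (M.lam m * M.psb P m))) := fun m => by
    have h1 := mul_le_mul_of_nonneg_left
      (abs_meanXi_sub_le hM hB1 hB3 m (M.limAgg P a m 0) (M.limAgg P a m 1) (M.fb (M.limBig P a))
        (M.limAgg P b m 0) (M.limAgg P b m 1) (M.fb (M.limBig P b))) (hf m).le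
    refine h1.trans ?_
    rw [mul_left_comm, ← hagg m 0, ← hagg m 1, ← mul_add, ← mul_add]
    exact mul_le_mul_of_nonneg_left (mul_le_mul_of_nonneg_left
      (add_le_add le_rfl (mul_le_mul_of_nonneg_left hbig hB3.vsig_nonneg)) (hf m).le)
      hB3.sig_nonneg
  have hnode : ∀ m, M.frac m * |a m - b m| * (M.meanShare P m 0 + M.meanShare P m 1
        + vsig * (M.lam m * M.psb P m))
      ≤ M.frac m * |a m - b m| * (1 - min (M.lam 0) (M.lam 1) * etaLow * (1 - vsig)) := fun m => by
    have h1 : min (M.lam 0) (M.lam 1) * etaLow ≤ M.lam m * M.psb P m :=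
      mul_le_mul (min_lam_le _) (hM.le_psb he m) he0 (hM.lam_nonneg _)
    have h2 := mul_le_mul_of_nonneg_right h1 (sub_nonneg.mpr hB3.vsig_le_one)
    have h3 := sum_meanShare_le (P := P) hM.lam_le_one m
    exact mul_le_mul_of_nonneg_left (by linarith) (mul_nonneg (hf m).le (abs_nonneg _))
  rw [Fin.sum_univ_two, Fin.sum_univ_two, kappa, mul_assoc]
  have ht0 := hterm 0
  have ht1 := hterm 1
  rw [Fin.sum_univ_two] at ht0 ht1
  refine (add_le_add ht0 ht1).trans ?_
  rw [← mul_add]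
  refine mul_le_mul_of_nonneg_left ?_ hB3.sig_nonneg
  have h0 := hnode 0
  have h1 := hnode 1
  rw [show M.frac 1 = 1 - M.frac 0 by linarith [frac_add_frac (M := M)]] at *
  linarith

theorem existsUnique_meanResponse_fixedPoint [IsProbabilityMeasure P] [MeasurableSpace 𝒢]
    (hM : M.IsRandomNetwork P) {y sig vsig etaLow : ℝ} (hB1 : M.AssumptionB1 y)
    (hB3 : M.AssumptionB3 P sig vsig) (he0 : 0 ≤ etaLow)
    (he : ∀ j, ∀ᵐ ω ∂P, etaLow ≤ M.etaSB j ω) (hpsb : ∀ m, M.psb P m < 1)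
    (hκ : M.kappa sig vsig etaLow < 1) : ∃! a, M.meanResponse P a = a := by
  have hf := frac_pos hM.gam_pos hM.gam_lt_one
  have hcontr := sum_abs_meanResponse_sub_le hM hB1 hB3 he0 he hpsb
  have hκ0 : 0 ≤ M.kappa sig vsig etaLow :=
    kappa_nonneg hB3.sig_nonneg hB3.vsig_nonneg hB3.vsig_le_one he0
      ((hM.le_psb he 0).trans (hpsb 0).le) hM.lam_nonneg hM.lam_le_one
  obtain ⟨a, ha⟩ := exists_fixedPoint_of_weighted_contraction hf hκ0 hκ (M.meanResponse P) hcontr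
  refine ⟨a, ha, fun b hb => ?_⟩
  have h := hcontr b a
  rw [ha, hb] at h
  have hnn : ∀ m ∈ Finset.univ, 0 ≤ M.frac m * |b m - a m| := fun m _ =>
    mul_nonneg (hf m).le (abs_nonneg _)
  have hzero : ∑ m, M.frac m * |b m - a m| = 0 := by
    have := Finset.sum_nonneg hnn
    nlinarith
  funext m
  have := (Finset.sum_eq_zero_iff_of_nonneg hnn).mp hzero m (Finset.mem_univ m)
  rcases mul_eq_zero.mp this with h | h
  · exact absurd h (hf m).ne'
  · exact sub_eq_zero.mp (abs_eq_zero.mp h)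

theorem limAgg_zero_one (h0 : 0 < M.gam) (h1 : M.gam < 1) (hlam : ∀ m, 0 < M.lam m)
    (hpsb : ∀ m, M.psb P m < 1) (a : Fin 2 → ℝ) :
    M.limAgg P a 0 1 = M.mu₁ P * M.limAgg P a 1 1 := by
  have hl := (hlam 1).ne'
  have hp : 1 - M.psb P 1 ≠ 0 := by linarith [hpsb 1]
  have hg : 1 - M.gam ≠ 0 := by linarith
  have hg0 := h0.ne'
  simp only [limAgg, mu₁, meanShare, frac, zero_ne_one, one_ne_zero, if_true, if_false]
  field_simp

theorem limAgg_one_zero (h0 : 0 < M.gam) (h1 : M.gam < 1) (hlam : ∀ m, 0 < M.lam m)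
    (hpsb : ∀ m, M.psb P m < 1) (a : Fin 2 → ℝ) :
    M.limAgg P a 1 0 = M.mu₂ P * M.limAgg P a 0 0 := by
  have hl := (hlam 0).ne'
  have hp : 1 - M.psb P 0 ≠ 0 := by linarith [hpsb 0]
  have hg : 1 - M.gam ≠ 0 := by linarith
  have hg0 := h0.ne'
  simp only [limAgg, mu₂, meanShare, frac, one_ne_zero, if_true, if_false]
  field_simp

theorem threeDimMap_eq (h0 : 0 < M.gam) (h1 : M.gam < 1) (z : ℝ × ℝ × ℝ) {a : Fin 2 → ℝ}
    (ha0 : a 0 = M.meanXi P 0 z.2.1 (M.mu₁ P * z.2.2) (M.fb z.1))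
    (ha1 : a 1 = M.meanXi P 1 (M.mu₂ P * z.2.1) z.2.2 (M.fb z.1)) :
    M.threeDimMap P z = (M.limBig P a, M.limAgg P a 0 0, M.limAgg P a 1 1) := by
  have hg : 1 - M.gam ≠ 0 := by linarith
  have hg0 := h0.ne'
  rw [threeDimMap, ← ha0, ← ha1]
  simp only [limBig, limAgg, meanShare, frac, Fin.sum_univ_two, one_ne_zero, if_true, if_false,
    Prod.mk.injEq]
  refine ⟨by ring, ?_, ?_⟩ <;> field_simp

/-- The fixed points of the three dimensional map are the aggregates of the fixed points of the
mean-field map. -/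
theorem isFixedPt_threeDimMap_iff (h0 : 0 < M.gam) (h1 : M.gam < 1) (hlam : ∀ m, 0 < M.lam m)
    (hpsb : ∀ m, M.psb P m < 1) {a : Fin 2 → ℝ} (ha : M.meanResponse P a = a)
    (huniq : ∀ b, M.meanResponse P b = b → b = a) (z : ℝ × ℝ × ℝ) :
    Function.IsFixedPt (M.threeDimMap P) z
      ↔ z = (M.limBig P a, M.limAgg P a 0 0, M.limAgg P a 1 1) := by
  constructor
  · intro hz
    set b : Fin 2 → ℝ := ![M.meanXi P 0 z.2.1 (M.mu₁ P * z.2.2) (M.fb z.1),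
      M.meanXi P 1 (M.mu₂ P * z.2.1) z.2.2 (M.fb z.1)] with hb
    have hzb : z = (M.limBig P b, M.limAgg P b 0 0, M.limAgg P b 1 1) :=
      hz.symm.trans (threeDimMap_eq h0 h1 z rfl rfl)
    have hfix : M.meanResponse P b = b := by
      have e1 : z.1 = M.limBig P b := by rw [hzb]
      have e2 : z.2.1 = M.limAgg P b 0 0 := by rw [hzb]
      have e3 : z.2.2 = M.limAgg P b 1 1 := by rw [hzb]
      funext m
      revert m
      rw [Fin.forall_fin_two]
      constructor
      · rw [meanResponse, limAgg_zero_one h0 h1 hlam hpsb, ← e1, ← e2, ← e3]; rfl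
      · rw [meanResponse, limAgg_one_zero h0 h1 hlam hpsb, ← e1, ← e2, ← e3]; rfl
    rw [← huniq b hfix]
    exact hzb
  · rintro rfl
    refine threeDimMap_eq h0 h1 _ ?_ ?_
    · rw [← limAgg_zero_one h0 h1 hlam hpsb]
      exact (congrFun ha 0).symm
    · rw [← limAgg_one_zero h0 h1 hlam hpsb]
      exact (congrFun ha 1).symm

end MeanField

/-! ### Typical realizations -/

section Typical

variable {Ω 𝒢 : Type*} [MeasurableSpace Ω] {P : Measure Ω} {M : Model Ω 𝒢}

theorem AssumptionB2.ae_tendsto_degDev {s : ℕ → Fin 2 → ℕ} (hB2 : M.AssumptionB2 P s) :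
    ∀ᵐ ω ∂P, ∀ m' m, 0 < M.edgeProb m' m →
      Tendsto (fun k => M.degDev (s k) ω m' m) atTop (𝓝 0) := by
  filter_upwards [hB2.own, hB2.cross] with ω h1 h2 m' m hq
  unfold degDev
  by_cases h : m = m'
  · subst h
    have := h1 m
    simpa only [edgeProb, if_true] using this
  · have hm : m = 1 - m' := by
      clear hq
      revert m m'
      decide
    have hq' : M.edgeProb m' m = M.pc m' := if_neg h
    rw [hq'] at hq ⊢
    rw [hm]
    exact h2 m' hq

variable [MeasurableSpace 𝒢]

theorem IsRandomNetwork.ae_isRegular (hM : M.IsRandomNetwork P) {sig vsig etaLow : ℝ}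
    (hB3 : M.AssumptionB3 P sig vsig) (he0 : 0 ≤ etaLow)
    (he : ∀ j, ∀ᵐ ω ∂P, etaLow ≤ M.etaSB j ω) : ∀ᵐ ω ∂P, M.IsRegular sig vsig etaLow ω := by
  filter_upwards [ae_all_iff.mpr hM.etaSB_mem, ae_all_iff.mpr he,
    ae_all_iff.mpr hB3.lipschitz_xi] with ω h1 h2 h3
  exact ⟨hM.lam_nonneg, hM.lam_le_one, fun j i => hM.I_eq j i ω, h1, h2, he0, hB3.sig_nonneg,
    hB3.sig_le_one, hB3.vsig_nonneg, hB3.vsig_le_one, h3, hB3.lipschitz_fb⟩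

end Typical

end Model

end RandomFP

theorem corollary2 {Ω 𝒢 : Type*} [MeasurableSpace Ω] [MeasurableSpace 𝒢]
    (P : Measure Ω) [IsProbabilityMeasure P]
    (M : RandomFP.Model Ω 𝒢) (s : ℕ → Fin 2 → ℕ) (y sig vsig etaLow : ℝ)
    (hM : M.IsRandomNetwork P) (hs : M.IsSizeSequence s)
    (hB1 : M.AssumptionB1 y) (hB2 : M.AssumptionB2 P s) (hB3 : M.AssumptionB3 P sig vsig)
    (hB4 : M.rho P ≤ 1)
    (hetaLow : 0 ≤ etaLow) (heta : ∀ j, ∀ᵐ ω ∂P, etaLow ≤ M.etaSB j ω)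
    (hcontr : sig * (1 - etaLow + vsig * etaLow) < 1)
    -- the denominators in the definition of the two constants `μ_1`, `μ_2` do not vanish
    (hlam : ∀ m, 0 < M.lam m) (hpsb : ∀ m, M.psb P m < 1) :
    ∃ (xb : ℝ) (x : Fin 2 → Fin 2 → ℝ),
      -- the relations between the limit aggregates
      x 0 1 = M.mu₁ P * x 1 1 ∧ x 1 0 = M.mu₂ P * x 0 0 ∧
      -- the unique fixed point of the three dimensional system
      (∀ z : ℝ × ℝ × ℝ, Function.IsFixedPt (M.threeDimMap P) z ↔ z = (xb, x 0 0, x 1 1)) ∧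
      ∀ᵐ ω ∂P,
        -- the constant sequence given by the limit is a fixed point of the limit system
        Function.IsFixedPt (M.limitMap s ω) (xb, fun i m' => x i.1 m') ∧
        -- the finite systems have fixed points
        (∀ k, ∃ X : ℝ × (RandomFP.Node → ℝ), Function.IsFixedPt (M.sysMap (s k) ω) X) ∧
        -- the aggregate fixed points converge along the whole sequence
        (∀ Z : ℕ → ℝ × (RandomFP.Node → Fin 2 → ℝ),
          (∀ k, Function.IsFixedPt (M.aggMap (s k) ω) (Z k)) →
            Tendsto (fun k => (Z k).1) atTop (𝓝 xb) ∧
            ∀ i m', Tendsto (fun k => (Z k).2 i m') atTop (𝓝 (x i.1 m'))) ∧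
        -- the fixed points of the original system, and their aggregates, converge along the
        -- whole sequence
        (∀ X : ℕ → ℝ × (RandomFP.Node → ℝ),
          (∀ k, Function.IsFixedPt (M.sysMap (s k) ω) (X k)) →
            Tendsto (fun k => M.aggBig (s k) ω (X k).2) atTop (𝓝 xb) ∧
            (∀ i m', Tendsto (fun k => M.agg (s k) ω (X k).2 i m') atTop (𝓝 (x i.1 m'))) ∧
            Tendsto (fun k => (X k).1) atTop (𝓝 (M.fb xb)) ∧
            ∀ i, Tendsto (fun k => (X k).2 i) atTop
              (𝓝 (M.f i.1 (M.G i ω) (x i.1 0) (x i.1 1) (M.etaBS i ω * M.fb xb)))) := by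
  have hκ : M.kappa sig vsig etaLow < 1 :=
    RandomFP.Model.kappa_lt_one hB3.sig_nonneg hB3.sig_le_one hB3.vsig_le_one hetaLow hlam hcontr
  have hf := RandomFP.Model.frac_pos hM.gam_pos hM.gam_lt_one
  obtain ⟨a, ha, huniq⟩ := RandomFP.Model.existsUnique_meanResponse_fixedPoint hM hB1 hB3 hetaLow
    heta hpsb hκ
  set xb := M.limBig P a with hxb
  set x := M.limAgg P a with hx
  have hmean : ∀ m, M.meanXi P m (x m 0) (x m 1) (M.fb xb) = a m := fun m => congrFun ha m
  refine ⟨xb, x, RandomFP.Model.limAgg_zero_one hM.gam_pos hM.gam_lt_one hlam hpsb a,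
    RandomFP.Model.limAgg_one_zero hM.gam_pos hM.gam_lt_one hlam hpsb a,
    RandomFP.Model.isFixedPt_threeDimMap_iff hM.gam_pos hM.gam_lt_one hlam hpsb ha huniq, ?_⟩
  have hreg := hM.ae_isRegular hB3 hetaLow heta
  have hedge := ae_all_iff.mpr fun m' => ae_all_iff.mpr fun m =>
    hM.ae_lln_edge hB1 (fun j m => hreg.mono fun ω h => h.share_mem j m) m' m
      (x m' 0) (x m' 1) (M.fb xb)
  have hbigs := ae_all_iff.mpr fun m => hM.ae_lln_big hB1 m (x m 0) (x m 1) (M.fb xb)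
  simp_rw [hmean] at hedge hbigs
  filter_upwards [hreg, hB2.ae_tendsto_degDev, hedge, hbigs] with ω hω hdeg hlln hllnb
  -- the performances that the limit aggregates produce
  set Y : RandomFP.Node → ℝ := fun j => M.xi ω j (x j.1 0) (x j.1 1) (M.fb xb) with hY
  have hYmem : ∀ j, Y j ∈ Set.Icc 0 y := fun j => hB1.f_mem _ _ _ _ _
  have hagg := hω.eventually_abs_agg_sub_le hs hf hB2.p_pos hdeg (Y := Y)
    (fun j => hB1.abs_xi_le ω j _ _ _) (c := fun m' m => M.meanShare P m' m * a m') hlln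
    (fun m' m hq => by rw [RandomFP.Model.meanShare_eq_zero hB2.p_pos hq, zero_mul])
  have hbig : Tendsto (fun k => M.aggBig (s k) ω Y) atTop (𝓝 xb) :=
    RandomFP.Model.tendsto_aggBig_of_lln hs hf hllnb
  have hconv : ∀ X : ℕ → ℝ × (RandomFP.Node → ℝ),
      (∀ k, Function.IsFixedPt (M.sysMap (s k) ω) (X k)) →
        Tendsto (fun k => M.aggBig (s k) ω (X k).2) atTop (𝓝 xb) ∧
          ∀ i m', Tendsto (fun k => M.agg (s k) ω (X k).2 i m') atTop (𝓝 (x i.1 m')) := by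
    intro X hX
    have hX' : ∀ k (i : RandomFP.Node), i.2 < s k i.1 →
        (X k).2 i = M.response (s k) ω (X k).2 i := fun k i hi => by
      have := (M.isFixedPt_sysMap_iff.mp (hX k)).2 i
      rwa [if_pos hi] at this
    have hXY : ∀ k (i : RandomFP.Node), i.2 < s k i.1 → |(X k).2 i - Y i| ≤ y := by
      intro k i hi
      have h1 : (X k).2 i ∈ Set.Icc 0 y := by
        rw [hX' k i hi]
        exact hB1.f_mem _ _ _ _ _
      have h2 := hYmem i
      exact abs_le.mpr ⟨by linarith [h1.1, h2.2], by linarith [h1.2, h2.1]⟩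
    have hD := hω.tendsto_average_sub hκ (fun j => rfl) hagg hbig (X := fun k => (X k).2) hX'
    exact ⟨hω.tendsto_aggBig hs hbig hD, hω.tendsto_agg hs hf hB2.p_pos hdeg hagg hXY hD⟩
  refine ⟨?_, fun k => hω.exists_isFixedPt_sysMap hκ (s k), ?_, ?_⟩
  · refine Prod.ext hbig.limsup_eq (funext fun i => funext fun m' => Tendsto.limsup_eq ?_)
    rw [Metric.tendsto_nhds]
    intro ε hε
    filter_upwards [hagg (ε / 2) (by positivity),
      (hs.tendsto_group hf i.1).eventually_gt_atTop i.2] with k h1 h2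
    simp only [RandomFP.Model.aggMap, if_pos h2]
    rw [Real.dist_eq]
    exact (h1 i h2 m').trans_lt (by linarith)
  · intro Z hZ
    choose X hX h1 h2 using fun k => RandomFP.Model.exists_isFixedPt_sysMap_of_aggMap (hZ k)
    obtain ⟨hb, hi⟩ := hconv X hX
    refine ⟨by simpa only [h1] using hb, fun i m' => (hi i m').congr' ?_⟩
    filter_upwards [(hs.tendsto_group hf i.1).eventually_gt_atTop i.2] with k hk
    rw [h2 k i hk]
  · intro X hX
    obtain ⟨hb, hi⟩ := hconv X hX
    have hfix := fun k => M.isFixedPt_sysMap_iff.mp (hX k)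
    have hfb : Tendsto (fun k => M.fb (M.aggBig (s k) ω (X k).2)) atTop (𝓝 (M.fb xb)) :=
      (hB1.continuous_fb.tendsto xb).comp hb
    refine ⟨hb, hi, hfb.congr fun k => (hfix k).1.symm, fun i => ?_⟩
    have hlim := ((hB1.continuous_f i.1 (M.G i ω)).tendsto _).comp
      ((hi i 0).prodMk_nhds ((hi i 1).prodMk_nhds (hfb.const_mul (M.etaBS i ω))))
    refine hlim.congr' ?_
    filter_upwards [(hs.tendsto_group hf i.1).eventually_gt_atTop i.2] with k hk
    have := (hfix k).2 i
    rw [if_pos hk] at this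
    exact this.symm
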